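/- Let $n\ge 0$, let $\Xi=\mathbb R^n\times(\mathbb R^n)'$ with symplectic form $\sigma((x,\xi),(y,\eta))=y\cdot\xi-x\cdot\eta$, and let $dX$ be $(2\pi)^{-n}$ times Lebesgue measure on $\Xi$. All function spaces are complex, and $\mathcal S'$ carries the strong dual topology. Put $\langle f,g\rangle=\int_\Xi f(X)g(X)\,dX$ (also for the duality of $\mathcal S'$ and $\mathcal S$), $\mathfrak e_X(Z)=e^{i\sigma(X,Z)}$ and $\widehat f(Y)=\int_\Xi e^{-i\sigma(Y,Z)}f(Z)\,dZ$. Let $\#$ be a bilinear, separately continuous, associative product on $\mathcal S(\Xi)$ satisfying: (A) $\overline{f\#g}=\overline g\#\overline f$ and $\int_\Xi (f\#g)\,dX=\int_\Xi fg\,dX$ for all $f,g\in\mathcal S(\Xi)$. Extend $\#$ to products of $u\in\mathcal S'(\Xi)$ with $g\in\mathcal S(\Xi)$ by $\langle u\#g,h\rangle=\langle u,g\#h\rangle$ and $\langle g\#u,h\rangle=\langle u,h\#g\rangle$ for $h\in\mathcal S(\Xi)$; (B) $\mathcal S(\Xi)\#\mathcal S'(\Xi)\#\mathcal S(\Xi)\subset\mathcal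 S(\Xi)$. For $u,v\in\mathcal S'(\Xi)$ and $f\in\mathcal S(\Xi)$ put $\langle u\#f\#v,h\rangle=\langle u,f\#v\#h\rangle$; (C) $\int_\Xi\langle \mathfrak e_{-Z}\#f\#\mathfrak e_Z,\,g\rangle\,dZ=\int_\Xi f(Z)\,dZ\int_\Xi g(Y)\,dY$ for all $f,g\in\mathcal S(\Xi)$. Let $\mathbf N$ be the unique continuous linear map of $\mathcal S'(\Xi\times\Xi)$ into itself with $\langle \mathbf N(f_1\otimes f_2),g_1\otimes g_2\rangle=\langle\widehat g_1\#f_1,\widehat g_2\#f_2\rangle$ for all $f_1,f_2,g_1,g_2\in\mathcal S(\Xi)$. The modulation mapping is $\mathbf M(F)=\mathbf N(F)\circ C$, where $C(X,Y)=(-X,X-Y)$, so that $[\mathbf M(f\otimes g)](X,Y)=\langle \mathfrak e_{-X}\#f,\mathfrak e_{X-Y}\#g\rangle$ for $f,g\in\mathcal S(\Xi)$. Let $\mathfrak L$ be a Banach space continuously embedded in $\mathcal S'(\Xi\times\Xi)$, and let $\mathbb M$ be any topological linear isomorphism of $\mathcal S'(\Xi\times\Xi)$. For $T\in\{\mathbf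 M,\mathbb M\}$ and $0\ne h\in\mathcal S(\Xi)$ put $$\mathfrak L^T_h=\{f\in\mathcal S'(\Xi): T(f\otimes h)\in\mathfrak L\},\qquad \|f\|_{\mathfrak L^T_h}=\|T(f\otimes h)\|_{\mathfrak L}.$$ Assume that $\mathbf M\circ\mathbb M^{-1}$ restricts to a bijection $\mathfrak L\to\mathfrak L$. Then for every $0\ne h\in\mathcal S(\Xi)$ the subspaces $\mathfrak L^{\mathbb M}_h$ and $\mathfrak L^{\mathbf M}_h$ of $\mathcal S'(\Xi)$ coincide, both $\|\cdot\|_{\mathfrak L^{\mathbb M}_h}$ and $\|\cdot\|_{\mathfrak L^{\mathbf M}_h}$ are Banach (that is, complete) norms on this space, and they are equivalent. -/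

import Mathlib

open MeasureTheory Filter Topology
open scoped SchwartzMap FourierTransform

noncomputable section

namespace ModulationSpaces

/-! ### Tempered distributions with the strong dual topology -/

/-- Tempered distributions on `E`: the strong dual of the Schwartz space, i.e. with the topology of
uniform convergence on bounded subsets of `𝓢(E, ℂ)`. -/
abbrev Tempered (E : Type*) [NormedAddCommGroup E] [NormedSpace ℝ E] : Type _ :=
  StrongDual ℂ 𝓢(E, ℂ)

/-! ### Tensor products and partial integration of Schwartz functions -/

section Tensor

variable {E F G : Type} [NormedAddCommGroup E] [NormedSpace ℝ E]
  [NormedAddCommGroup F] [NormedSpace ℝ F] [NormedAddCommGroup G] [NormedSpace ℂ G]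

theorem tensor_decay (f : 𝓢(E, ℂ)) (g : 𝓢(F, ℂ)) (k n : ℕ) :
    ∃ C : ℝ, ∀ z : E × F,
      ‖z‖ ^ k * ‖iteratedFDeriv ℝ n (fun z : E × F => f z.1 * g z.2) z‖ ≤ C := by
  have hf : ContDiff ℝ n (fun z : E × F => f z.1) := (f.smooth n).comp contDiff_fst
  have hg : ContDiff ℝ n (fun z : E × F => g z.2) := (g.smooth n).comp contDiff_snd
  have h1 : ∀ (i : ℕ) (z : E × F),
      ‖iteratedFDeriv ℝ i (fun z : E × F => f z.1) z‖ ≤ ‖iteratedFDeriv ℝ i f z.1‖ := by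
    intro i z
    have := (ContinuousLinearMap.fst ℝ E F).iteratedFDeriv_comp_right (f.smooth i) z le_rfl
    have e : (fun z : E × F => f z.1) = f ∘ (ContinuousLinearMap.fst ℝ E F) := rfl
    rw [e, this]
    refine (ContinuousMultilinearMap.norm_compContinuousLinearMap_le _ _).trans ?_
    refine mul_le_of_le_one_right (norm_nonneg _) ?_
    exact Finset.prod_le_one (fun _ _ => norm_nonneg _)
      (fun _ _ => ContinuousLinearMap.norm_fst_le ℝ E F)
  have h2 : ∀ (i : ℕ) (z : E × F),
      ‖iteratedFDeriv ℝ i (fun z : E × F => g z.2) z‖ ≤ ‖iteratedFDeriv ℝ i g z.2‖ := by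
    intro i z
    have := (ContinuousLinearMap.snd ℝ E F).iteratedFDeriv_comp_right (g.smooth i) z le_rfl
    have e : (fun z : E × F => g z.2) = g ∘ (ContinuousLinearMap.snd ℝ E F) := rfl
    rw [e, this]
    refine (ContinuousMultilinearMap.norm_compContinuousLinearMap_le _ _).trans ?_
    refine mul_le_of_le_one_right (norm_nonneg _) ?_
    exact Finset.prod_le_one (fun _ _ => norm_nonneg _)
      (fun _ _ => ContinuousLinearMap.norm_snd_le ℝ E F)
  refine ⟨∑ i ∈ Finset.range (n + 1), (n.choose i : ℝ) *
    (SchwartzMap.seminorm ℝ k i f * SchwartzMap.seminorm ℝ 0 (n - i) g +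
      SchwartzMap.seminorm ℝ 0 i f * SchwartzMap.seminorm ℝ k (n - i) g), fun z => ?_⟩
  have hm := norm_iteratedFDeriv_mul_le hf hg z (n := n) le_rfl
  refine (mul_le_mul_of_nonneg_left hm (by positivity)).trans ?_
  rw [Finset.mul_sum]
  refine Finset.sum_le_sum fun i _ => ?_
  have hz : ‖z‖ ^ k ≤ ‖z.1‖ ^ k + ‖z.2‖ ^ k := by
    rcases le_total ‖z.1‖ ‖z.2‖ with h | h
    · rw [Prod.norm_def, max_eq_right h]; exact le_add_of_nonneg_left (by positivity)
    · rw [Prod.norm_def, max_eq_left h]; exact le_add_of_nonneg_right (by positivity)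
  have a1 := f.le_seminorm ℝ k i z.1
  have a2 := f.le_seminorm ℝ 0 i z.1
  have b1 := g.le_seminorm ℝ k (n - i) z.2
  have b2 := g.le_seminorm ℝ 0 (n - i) z.2
  rw [pow_zero, one_mul] at a2 b2
  calc ‖z‖ ^ k * ((n.choose i : ℝ) * ‖iteratedFDeriv ℝ i (fun z : E × F => f z.1) z‖ *
        ‖iteratedFDeriv ℝ (n - i) (fun z : E × F => g z.2) z‖)
      ≤ (‖z.1‖ ^ k + ‖z.2‖ ^ k) * ((n.choose i : ℝ) * ‖iteratedFDeriv ℝ i f z.1‖ *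
        ‖iteratedFDeriv ℝ (n - i) g z.2‖) := by
        gcongr
        · exact h1 i z
        · exact h2 (n - i) z
    _ = (n.choose i : ℝ) * ((‖z.1‖ ^ k * ‖iteratedFDeriv ℝ i f z.1‖) *
          ‖iteratedFDeriv ℝ (n - i) g z.2‖ +
          ‖iteratedFDeriv ℝ i f z.1‖ * (‖z.2‖ ^ k * ‖iteratedFDeriv ℝ (n - i) g z.2‖)) := by ring
    _ ≤ _ := by gcongr

/-- The elementary tensor `(f ⊗ g)(X, Y) = f(X) g(Y)` of two Schwartz functions. -/
def tensor (f : 𝓢(E, ℂ)) (g : 𝓢(F, ℂ)) : 𝓢(E × F, ℂ) where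
  toFun z := f z.1 * g z.2
  smooth' := ((f.smooth _).comp contDiff_fst).mul ((g.smooth _).comp contDiff_snd)
  decay' := tensor_decay f g

@[simp] theorem tensor_apply (f : 𝓢(E, ℂ)) (g : 𝓢(F, ℂ)) (z : E × F) :
    tensor f g z = f z.1 * g z.2 := rfl

/-- The derivative of a Schwartz function in the first variable. -/
def partialFst (Φ : 𝓢(E × F, G)) : 𝓢(E × F, E →L[ℝ] G) :=
  (SchwartzMap.fderivCLM ℝ (E × F) G Φ).postcompCLM
    ((ContinuousLinearMap.compL ℝ E (E × F) G).flip (ContinuousLinearMap.inl ℝ E F))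

theorem partialFst_apply (Φ : 𝓢(E × F, G)) (z : E × F) :
    partialFst Φ z = (fderiv ℝ Φ z).comp (ContinuousLinearMap.inl ℝ E F) := rfl

theorem seminorm_partialFst_le (Φ : 𝓢(E × F, G)) (k n : ℕ) :
    SchwartzMap.seminorm ℝ k n (partialFst Φ) ≤ SchwartzMap.seminorm ℝ k (n + 1) Φ := by
  refine SchwartzMap.seminorm_le_bound ℝ k n _ (by positivity) fun z => ?_
  refine le_trans ?_ (Φ.le_seminorm ℝ k (n + 1) z)
  gcongr
  rw [← norm_iteratedFDeriv_fderiv]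
  set L : ((E × F) →L[ℝ] G) →L[ℝ] (E →L[ℝ] G) :=
    (ContinuousLinearMap.compL ℝ E (E × F) G).flip (ContinuousLinearMap.inl ℝ E F) with hL
  have hLn : ‖L‖ ≤ 1 := by
    refine ContinuousLinearMap.opNorm_le_bound _ zero_le_one fun T => ?_
    rw [one_mul]
    refine (ContinuousLinearMap.opNorm_comp_le T (ContinuousLinearMap.inl ℝ E F)).trans ?_
    exact mul_le_of_le_one_right (norm_nonneg _) (ContinuousLinearMap.norm_inl_le_one ℝ E F)
  have e : (partialFst Φ : E × F → E →L[ℝ] G) = L ∘ fderiv ℝ Φ := rfl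
  have hs : ContDiff ℝ n (fderiv ℝ Φ) :=
    (Φ.smooth (n + 1)).fderiv_right (m := n) (by norm_cast)
  rw [e, L.iteratedFDeriv_comp_left hs.contDiffAt le_rfl]
  refine (ContinuousLinearMap.norm_compContinuousMultilinearMap_le _ _).trans ?_
  exact mul_le_of_le_one_left (norm_nonneg _) hLn

theorem norm_smul_partial_le (h : 𝓢(F, ℂ)) (Φ : 𝓢(E × F, G)) (k : ℕ) (X : E) (Y : F) :
    ‖X‖ ^ k * ‖h Y • Φ (X, Y)‖ ≤ ‖h Y‖ * SchwartzMap.seminorm ℝ k 0 Φ := by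
  have h1 := Φ.norm_pow_mul_le_seminorm ℝ k (X, Y)
  have h2 : ‖X‖ ^ k ≤ ‖(X, Y)‖ ^ k := by gcongr; exact norm_fst_le (X, Y)
  rw [norm_smul]
  calc ‖X‖ ^ k * (‖h Y‖ * ‖Φ (X, Y)‖) ≤ ‖(X, Y)‖ ^ k * (‖h Y‖ * ‖Φ (X, Y)‖) := by gcongr
    _ = ‖h Y‖ * (‖(X, Y)‖ ^ k * ‖Φ (X, Y)‖) := by ring
    _ ≤ _ := by gcongr

variable [MeasurableSpace F] [BorelSpace F] [SecondCountableTopology F]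
  (μ : Measure F) [μ.HasTemperateGrowth]

theorem integrable_smul_partial (h : 𝓢(F, ℂ)) (Φ : 𝓢(E × F, G)) (X : E) :
    Integrable (fun Y => h Y • Φ (X, Y)) μ := by
  refine ((h.integrable (μ := μ)).norm.mul_const (SchwartzMap.seminorm ℝ 0 0 Φ)).mono' ?_ ?_
  · exact (h.continuous.smul (Φ.continuous.comp (by fun_prop))).aestronglyMeasurable
  · refine Eventually.of_forall fun Y => ?_
    simpa using norm_smul_partial_le h Φ 0 X Y

/-- The function `X ↦ ∫ h(Y) Φ(X, Y) dμ(Y)`. -/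
def partialIntegral (h : 𝓢(F, ℂ)) (Φ : 𝓢(E × F, G)) (X : E) : G :=
  ∫ Y, h Y • Φ (X, Y) ∂μ

theorem hasFDerivAt_partialIntegral (h : 𝓢(F, ℂ)) (Φ : 𝓢(E × F, G)) (X : E) :
    HasFDerivAt (partialIntegral μ h Φ) (partialIntegral μ h (partialFst Φ) X) X := by
  refine hasFDerivAt_integral_of_dominated_of_fderiv_le (𝕜 := ℝ)
    (F := fun X Y => h Y • Φ (X, Y)) (F' := fun X Y => h Y • partialFst Φ (X, Y))
    (s := Set.univ) (bound := fun Y => ‖h Y‖ * SchwartzMap.seminorm ℝ 0 0 (partialFst Φ))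
    univ_mem ?_ ?_ ?_ ?_ ?_ ?_
  · exact Eventually.of_forall fun X => (integrable_smul_partial μ h Φ X).aestronglyMeasurable
  · exact integrable_smul_partial μ h Φ X
  · exact (integrable_smul_partial μ h (partialFst Φ) X).aestronglyMeasurable
  · refine Eventually.of_forall fun Y X _ => ?_
    simpa using norm_smul_partial_le h (partialFst Φ) 0 X Y
  · exact (h.integrable (μ := μ)).norm.mul_const _
  · refine Eventually.of_forall fun Y X _ => ?_
    have h1 : HasFDerivAt (fun X : E => (X, Y)) (ContinuousLinearMap.inl ℝ E F) X :=
      hasFDerivAt_prodMk_left X Y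
    have h2 : HasFDerivAt Φ (fderiv ℝ Φ (X, Y)) (X, Y) := Φ.hasFDerivAt (X, Y)
    exact (h2.comp X h1).const_smul (h Y)

theorem fderiv_partialIntegral (h : 𝓢(F, ℂ)) (Φ : 𝓢(E × F, G)) :
    fderiv ℝ (partialIntegral μ h Φ) = partialIntegral μ h (partialFst Φ) :=
  funext fun X => (hasFDerivAt_partialIntegral μ h Φ X).fderiv

end Tensor

theorem contDiff_partialIntegral {E F : Type} [NormedAddCommGroup E] [NormedSpace ℝ E]
    [NormedAddCommGroup F] [NormedSpace ℝ F] [MeasurableSpace F] [BorelSpace F]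
    [SecondCountableTopology F] (μ : Measure F) [μ.HasTemperateGrowth] (h : 𝓢(F, ℂ)) (n : ℕ) :
    ∀ {G : Type} [NormedAddCommGroup G] [NormedSpace ℂ G] (Φ : 𝓢(E × F, G)),
      ContDiff ℝ n (partialIntegral μ h Φ) := by
  induction n with
  | zero =>
    intro G _ _ Φ
    rw [Nat.cast_zero, contDiff_zero]
    exact continuous_iff_continuousAt.2 fun X => (hasFDerivAt_partialIntegral μ h Φ X).continuousAt
  | succ n ih =>
    intro G _ _ Φ
    rw [Nat.cast_succ, contDiff_succ_iff_fderiv]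
    refine ⟨fun X => (hasFDerivAt_partialIntegral μ h Φ X).differentiableAt, by simp, ?_⟩
    rw [fderiv_partialIntegral]
    exact ih _

theorem decay_partialIntegral {E F : Type} [NormedAddCommGroup E] [NormedSpace ℝ E]
    [NormedAddCommGroup F] [NormedSpace ℝ F] [MeasurableSpace F] [BorelSpace F]
    [SecondCountableTopology F] (μ : Measure F) [μ.HasTemperateGrowth] (h : 𝓢(F, ℂ)) (k n : ℕ) :
    ∀ {G : Type} [NormedAddCommGroup G] [NormedSpace ℂ G] (Φ : 𝓢(E × F, G)) (X : E),
      ‖X‖ ^ k * ‖iteratedFDeriv ℝ n (partialIntegral μ h Φ) X‖ ≤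
        (∫ Y, ‖h Y‖ ∂μ) * SchwartzMap.seminorm ℝ k n Φ := by
  induction n with
  | zero =>
    intro G _ _ Φ X
    rw [norm_iteratedFDeriv_zero]
    have h1 : ‖X‖ ^ k * ‖partialIntegral μ h Φ X‖ ≤ ∫ Y, ‖X‖ ^ k * ‖h Y • Φ (X, Y)‖ ∂μ := by
      rw [integral_const_mul]
      gcongr
      exact norm_integral_le_integral_norm _
    refine h1.trans ?_
    rw [← integral_mul_const]
    exact integral_mono ((integrable_smul_partial μ h Φ X).norm.const_mul _)
      ((h.integrable (μ := μ)).norm.mul_const _) fun Y => norm_smul_partial_le h Φ k X Y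
  | succ n ih =>
    intro G _ _ Φ X
    rw [← norm_iteratedFDeriv_fderiv, fderiv_partialIntegral]
    refine (ih _ X).trans ?_
    gcongr
    exact seminorm_partialFst_le Φ k n

section Window

variable {E F : Type} [NormedAddCommGroup E] [NormedSpace ℝ E]
  [NormedAddCommGroup F] [NormedSpace ℝ F] [MeasurableSpace F] [BorelSpace F]
  [SecondCountableTopology F] (μ : Measure F) [μ.HasTemperateGrowth]

/-- Integration of a Schwartz function against a window in the second variable,
`Φ ↦ (X ↦ ∫ h(Y) Φ(X, Y) dμ(Y))`, as a continuous linear map of Schwartz spaces. -/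
def contractSnd (h : 𝓢(F, ℂ)) : 𝓢(E × F, ℂ) →L[ℂ] 𝓢(E, ℂ) :=
  SchwartzMap.mkCLM (fun Φ X => partialIntegral μ h Φ X)
    (fun Φ Ψ X => by
      simp only [partialIntegral, add_apply, smul_add]
      exact integral_add (integrable_smul_partial μ h Φ X) (integrable_smul_partial μ h Ψ X))
    (fun a Φ X => by
      simp only [partialIntegral, smul_apply, RingHom.id_apply]
      rw [← integral_smul]
      exact integral_congr_ae (Eventually.of_forall fun Y => smul_comm _ _ _))
    (fun Φ => contDiff_infty.2 fun n => contDiff_partialIntegral μ h n Φ)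
    (fun m => ⟨{m}, ∫ Y, ‖h Y‖ ∂μ, integral_nonneg fun Y => norm_nonneg _, fun Φ X => by
      rw [Finset.sup_singleton]
      exact decay_partialIntegral μ h m.1 m.2 Φ X⟩)

theorem contractSnd_apply (h : 𝓢(F, ℂ)) (Φ : 𝓢(E × F, ℂ)) (X : E) :
    contractSnd μ h Φ X = ∫ Y, h Y * Φ (X, Y) ∂μ := rfl

/-- The tensor product `f ⊗ h` of a tempered distribution `f` on `E` with the Schwartz function
`h` on `F` (viewed as a distribution through the measure `μ`), as a continuous linear map in `f`:
`⟨f ⊗ h, Φ⟩ = ⟨f, ∫ h(Y) Φ(·, Y) dμ(Y)⟩`. -/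
def tensorWindow (h : 𝓢(F, ℂ)) : Tempered E →L[ℂ] Tempered (E × F) :=
  ContinuousLinearMap.precomp ℂ (contractSnd μ h)

theorem tensorWindow_apply (h : 𝓢(F, ℂ)) (f : Tempered E) (Φ : 𝓢(E × F, ℂ)) :
    tensorWindow μ h f Φ = f (contractSnd μ h Φ) := rfl

end Window

/-! ### Phase space -/

/-- The phase space `Ξ = ℝⁿ × (ℝⁿ)'`, whose points are `X = (x, ξ)` with `x = X.fst`, `ξ = X.snd`. -/
abbrev Phase (n : ℕ) : Type :=
  WithLp 2 (EuclideanSpace ℝ (Fin n) × EuclideanSpace ℝ (Fin n))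

variable {n : ℕ}

/-- The symplectic form `σ((x, ξ), (y, η)) = y · ξ - x · η`. -/
def symp (X Y : Phase n) : ℝ := inner ℝ Y.fst X.snd - inner ℝ X.fst Y.snd

/-- The Haar measure on `Ξ` for which the symplectic Fourier transformation is unitary:
`(2π)⁻ⁿ` times Lebesgue measure. -/
def haarΞ (n : ℕ) : Measure (Phase n) := ENNReal.ofReal (((2 * Real.pi) ^ n)⁻¹) • volume

instance (n : ℕ) : (haarΞ n).IsAddHaarMeasure :=
  Measure.IsAddHaarMeasure.smul volume (by simp; positivity) ENNReal.ofReal_ne_top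

theorem integral_haarΞ (f : Phase n → ℂ) :
    ∫ X, f X ∂(haarΞ n) = (((2 * Real.pi) ^ n)⁻¹ : ℝ) • ∫ X, f X := by
  rw [haarΞ, integral_smul_measure, ENNReal.toReal_ofReal (by positivity)]

/-- The linear isomorphism `(y, η) ↦ ((2π)⁻¹ η, -(2π)⁻¹ y)` of phase space. -/
def rotate (n : ℕ) : Phase n ≃L[ℝ] Phase n :=
  (WithLp.prodContinuousLinearEquiv 2 ℝ _ _).trans
    ((ContinuousLinearEquiv.prodComm ℝ _ _).trans
      ((ContinuousLinearEquiv.prodCongr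
        (ContinuousLinearEquiv.smulLeft (Units.mk0 ((2 * Real.pi)⁻¹ : ℝ) (by positivity)))
        (ContinuousLinearEquiv.smulLeft (Units.mk0 (-(2 * Real.pi)⁻¹ : ℝ)
          (neg_ne_zero.2 (by positivity))))).trans
        (WithLp.prodContinuousLinearEquiv 2 ℝ _ _).symm))

theorem rotate_apply (Y : Phase n) :
    rotate n Y = WithLp.toLp 2 ((2 * Real.pi)⁻¹ • Y.snd, (-(2 * Real.pi)⁻¹) • Y.fst) := rfl

/-- The symplectic Fourier transformation of Schwartz functions,
`f̂(Y) = ∫ exp(-iσ(Y, Z)) f(Z) dZ`; see `sympFourier_apply`. -/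
def sympFourier (n : ℕ) : 𝓢(Phase n, ℂ) →L[ℂ] 𝓢(Phase n, ℂ) :=
  (((2 * Real.pi) ^ n)⁻¹ : ℝ) •
    (SchwartzMap.compCLMOfContinuousLinearEquiv ℂ (rotate n) ∘L
      (FourierTransform.fourierCLM ℂ 𝓢(Phase n, ℂ)))

theorem sympFourier_apply (f : 𝓢(Phase n, ℂ)) (Y : Phase n) :
    sympFourier n f Y = ∫ Z, Complex.exp (-Complex.I * symp Y Z) * f Z ∂(haarΞ n) := by
  rw [integral_haarΞ]
  change (((2 * Real.pi) ^ n)⁻¹ : ℝ) • (FourierTransform.fourier (f : Phase n → ℂ)) (rotate n Y) = _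
  rw [Real.fourier_eq']
  congr 1
  refine integral_congr_ae (Eventually.of_forall fun Z => ?_)
  have h : inner ℝ Z (rotate n Y) = (2 * Real.pi)⁻¹ * symp Y Z := by
    have e1 : Z.ofLp.1 = Z.fst := rfl
    have e2 : Z.ofLp.2 = Z.snd := rfl
    rw [rotate_apply, WithLp.prod_inner_apply, e1, e2]
    simp only [symp, inner_smul_right, real_inner_comm Z.snd Y.fst]
    ring
  have hp : (Real.pi : ℂ) ≠ 0 := by exact_mod_cast Real.pi_ne_zero
  simp only [h, smul_eq_mul]
  congr 2
  push_cast
  field_simp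

/-- The bilinear pairing `⟨f, g⟩ = ∫ f(X) g(X) dX` of Schwartz functions on phase space, as a map
embedding Schwartz functions into tempered distributions. -/
def toTempered (f : 𝓢(Phase n, ℂ)) : Tempered (Phase n) :=
  (SchwartzMap.integralCLM ℂ (haarΞ n)) ∘L (SchwartzMap.pairing (ContinuousLinearMap.mul ℂ ℂ) f)

theorem toTempered_apply (f g : 𝓢(Phase n, ℂ)) :
    toTempered f g = ∫ X, f X * g X ∂(haarΞ n) := rfl

/-- Complex conjugation of Schwartz functions. -/
def conjS (f : 𝓢(Phase n, ℂ)) : 𝓢(Phase n, ℂ) :=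
  f.postcompCLM (Complex.conjCLE : ℂ →L[ℝ] ℂ)

theorem conjS_apply (f : 𝓢(Phase n, ℂ)) (X : Phase n) :
    conjS f X = (starRingEnd ℂ) (f X) := rfl

/-- The exponential `e_X(Z) = exp(iσ(X, Z))` as a tempered distribution, i.e. the functional
`h ↦ ∫ exp(iσ(X, Z)) h(Z) dZ`; see `expo_apply`. -/
def expo (X : Phase n) : Tempered (Phase n) :=
  (BoundedContinuousFunction.evalCLM ℂ (-X)) ∘L
    (SchwartzMap.toBoundedContinuousFunctionCLM ℂ (Phase n) ℂ) ∘L (sympFourier n)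

theorem expo_apply (X : Phase n) (h : 𝓢(Phase n, ℂ)) :
    expo X h = ∫ Z, Complex.exp (Complex.I * symp X Z) * h Z ∂(haarΞ n) := by
  change sympFourier n h (-X) = _
  rw [sympFourier_apply]
  have hs : ∀ Z, symp (-X) Z = -symp X Z := fun Z => by
    simp only [symp, WithLp.neg_fst, WithLp.neg_snd, inner_neg_left, inner_neg_right]
    ring
  simp [hs]

/-! ### Composition laws on the Schwartz space of phase space -/

/-- An associative, separately continuous bilinear composition law `#` on `𝓢(Ξ)` which makes `𝓢(Ξ)`
a `*`-algebra with complex conjugation as involution, and such that `∫ f # g = ∫ f g`. -/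
structure CompositionLaw (n : ℕ) where
  /-- The product `f # g`. -/
  mul : 𝓢(Phase n, ℂ) →ₗ[ℂ] 𝓢(Phase n, ℂ) →ₗ[ℂ] 𝓢(Phase n, ℂ)
  continuous_right : ∀ f, Continuous fun g => mul f g
  continuous_left : ∀ g, Continuous fun f => mul f g
  assoc : ∀ f g h, mul (mul f g) h = mul f (mul g h)
  conj_mul : ∀ f g, conjS (mul f g) = mul (conjS g) (conjS f)
  integral_mul : ∀ f g, ∫ X, mul f g X ∂(haarΞ n) = ∫ X, f X * g X ∂(haarΞ n)

namespace CompositionLaw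

variable (S : CompositionLaw n)

/-- Left multiplication `g ↦ f # g` on `𝓢(Ξ)`. -/
def lmul (f : 𝓢(Phase n, ℂ)) : 𝓢(Phase n, ℂ) →L[ℂ] 𝓢(Phase n, ℂ) :=
  ⟨S.mul f, S.continuous_right f⟩

/-- Right multiplication `g ↦ g # f` on `𝓢(Ξ)`. -/
def rmul (f : 𝓢(Phase n, ℂ)) : 𝓢(Phase n, ℂ) →L[ℂ] 𝓢(Phase n, ℂ) :=
  ⟨S.mul.flip f, S.continuous_left f⟩

/-- The product `g # u` for `g ∈ 𝓢(Ξ)`, `u ∈ 𝓢'(Ξ)`: `⟨g # u, h⟩ = ⟨u, h # g⟩`. -/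
def smulDist (g : 𝓢(Phase n, ℂ)) (u : Tempered (Phase n)) : Tempered (Phase n) := u ∘L S.rmul g

/-- The product `u # g` for `u ∈ 𝓢'(Ξ)`, `g ∈ 𝓢(Ξ)`: `⟨u # g, h⟩ = ⟨u, g # h⟩`. -/
def distSmul (u : Tempered (Phase n)) (g : 𝓢(Phase n, ℂ)) : Tempered (Phase n) := u ∘L S.lmul g

/-- The regularity requirement `𝓢(Ξ) # 𝓢'(Ξ) # 𝓢(Ξ) ⊆ 𝓢(Ξ)`. -/
def Regular : Prop :=
  ∀ (f g : 𝓢(Phase n, ℂ)) (u : Tempered (Phase n)),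
    ∃ k : 𝓢(Phase n, ℂ), toTempered k = S.distSmul (S.smulDist f u) g

variable {S}

/-- The Schwartz function `f # u # g`, for `f, g ∈ 𝓢(Ξ)` and `u ∈ 𝓢'(Ξ)`. -/
def sandwich (hB : S.Regular) (f : 𝓢(Phase n, ℂ)) (u : Tempered (Phase n)) (g : 𝓢(Phase n, ℂ)) :
    𝓢(Phase n, ℂ) :=
  (hB f g u).choose

/-- The product `u # f # v` for `u, v ∈ 𝓢'(Ξ)` and `f ∈ 𝓢(Ξ)`, as a functional on `𝓢(Ξ)`:
`⟨u # f # v, h⟩ = ⟨u, f # v # h⟩`. -/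
def distSandwich (hB : S.Regular) (u : Tempered (Phase n)) (f : 𝓢(Phase n, ℂ))
    (v : Tempered (Phase n)) (h : 𝓢(Phase n, ℂ)) : ℂ :=
  u (sandwich hB f v h)

/-- The functional `Θ_Z(f) = e_{-Z} # f # e_Z`. -/
def theta (hB : S.Regular) (Z : Phase n) (f : 𝓢(Phase n, ℂ)) : 𝓢(Phase n, ℂ) → ℂ :=
  distSandwich hB (expo (-Z)) f (expo Z)

/-- The orthogonality requirement `∫ ⟨Θ_Z(f), g⟩ dZ = ∫ f(Z) dZ · ∫ g(Y) dY` on `𝓢(Ξ)`. -/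
def Orthogonal (hB : S.Regular) : Prop :=
  ∀ f g : 𝓢(Phase n, ℂ),
    ∫ Z, theta hB Z f g ∂(haarΞ n) = (∫ Z, f Z ∂(haarΞ n)) * ∫ Y, g Y ∂(haarΞ n)

end CompositionLaw

/-! ### The modulation mapping -/

/-- `f ⊗ h` for `f ∈ 𝓢'(Ξ)` and `h ∈ 𝓢(Ξ)`, as a continuous linear map `J_h` in `f`. -/
def windowMap (h : 𝓢(Phase n, ℂ)) : Tempered (Phase n) →L[ℂ] Tempered (Phase n × Phase n) :=
  tensorWindow (haarΞ n) h

/-- The change of variables `C(X, Y) = (-X, X - Y)` of `Ξ × Ξ`. -/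
def changeVar (n : ℕ) : (Phase n × Phase n) ≃L[ℝ] (Phase n × Phase n) :=
  ContinuousLinearEquiv.equivOfInverse
    ((-ContinuousLinearMap.fst ℝ (Phase n) (Phase n)).prod
      (ContinuousLinearMap.fst ℝ (Phase n) (Phase n) -
        ContinuousLinearMap.snd ℝ (Phase n) (Phase n)))
    ((-ContinuousLinearMap.fst ℝ (Phase n) (Phase n)).prod
      (-ContinuousLinearMap.fst ℝ (Phase n) (Phase n) -
        ContinuousLinearMap.snd ℝ (Phase n) (Phase n)))
    (fun z => by ext1 <;> simp) (fun z => by ext1 <;> simp)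

theorem changeVar_apply (X Y : Phase n) : changeVar n (X, Y) = (-X, X - Y) := rfl

/-- The map `F ↦ F ∘ C` on `𝓢'(Ξ × Ξ)`: as `C` preserves the measure of `Ξ × Ξ`, one has
`⟨F ∘ C, G⟩ = ⟨F, G ∘ C⁻¹⟩`. -/
def compChangeVar (n : ℕ) : Tempered (Phase n × Phase n) →L[ℂ] Tempered (Phase n × Phase n) :=
  ContinuousLinearMap.precomp ℂ
    (SchwartzMap.compCLMOfContinuousLinearEquiv ℂ (changeVar n).symm)

namespace CompositionLaw

variable (S : CompositionLaw n)

/-- A continuous linear map `N` of `𝓢'(Ξ × Ξ)` extends the `N`-function of `#` if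
`⟨N(f₁ ⊗ f₂), g₁ ⊗ g₂⟩ = ⟨ĝ₁ # f₁, ĝ₂ # f₂⟩` for all Schwartz functions. -/
def IsNExtension (N : Tempered (Phase n × Phase n) →L[ℂ] Tempered (Phase n × Phase n)) : Prop :=
  ∀ f₁ f₂ g₁ g₂ : 𝓢(Phase n, ℂ),
    N (windowMap f₂ (toTempered f₁)) (tensor g₁ g₂) =
      ∫ X, S.mul (sympFourier n g₁) f₁ X * S.mul (sympFourier n g₂) f₂ X ∂(haarΞ n)

open Classical in
/-- The `N`-function of `#` on `𝓢'(Ξ × Ξ)`: the continuous linear map given by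
`⟨N(f₁ ⊗ f₂), g₁ ⊗ g₂⟩ = ⟨ĝ₁ # f₁, ĝ₂ # f₂⟩` on elementary tensors of Schwartz functions. (There is at
most one such map, by density; the value `0` is used when the law admits none.) -/
def nMap : Tempered (Phase n × Phase n) →L[ℂ] Tempered (Phase n × Phase n) :=
  if h : ∃ N, S.IsNExtension N then h.choose else 0

/-- The modulation mapping of `#` on `𝓢'(Ξ × Ξ)`, `M(F) = N(F) ∘ C`; formally
`M(f ⊗ g)(X, Y) = ⟨e_{-X} # f, e_{X-Y} # g⟩`. -/
def modulation : Tempered (Phase n × Phase n) →L[ℂ] Tempered (Phase n × Phase n) :=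
  compChangeVar n ∘L S.nMap

end CompositionLaw

/-! ### Induced spaces -/

section Induced

variable {L : Type*} [NormedAddCommGroup L] [NormedSpace ℂ L]
  (j : L →L[ℂ] Tempered (Phase n × Phase n))
  (T : Tempered (Phase n × Phase n) →L[ℂ] Tempered (Phase n × Phase n)) (h : 𝓢(Phase n, ℂ))

/-- The subspace of `𝓢'(Ξ)` induced from the image of `j : L → 𝓢'(Ξ × Ξ)` by the mapping `T` and
the window `h`: all `f` with `T(f ⊗ h) ∈ L`. -/
def inducedSpace : Submodule ℂ (Tempered (Phase n)) :=
  (LinearMap.range j.toLinearMap).comap (T ∘L windowMap h).toLinearMap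

/-- The linear map `f ↦ T(f ⊗ h)` from the induced space to `L`, for an injective `j`. -/
def inducedMap (hj : Function.Injective j) : inducedSpace j T h →ₗ[ℂ] L :=
  (LinearEquiv.ofInjective j.toLinearMap hj).symm.toLinearMap ∘ₗ
    (T ∘L windowMap h).toLinearMap.restrict (p := inducedSpace j T h) (fun _ hf => hf)

theorem inducedMap_spec (hj : Function.Injective j) (f : inducedSpace j T h) :
    j (inducedMap j T h hj f) = T (windowMap h f) :=
  congrArg Subtype.val ((LinearEquiv.ofInjective j.toLinearMap hj).apply_symm_apply _)

/-- The (semi)norm `‖f‖ = ‖T(f ⊗ h)‖_L` on the induced space. -/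
def inducedNorm (hj : Function.Injective j) : Seminorm ℂ (inducedSpace j T h) :=
  (normSeminorm ℂ L).comp (inducedMap j T h hj)

theorem inducedNorm_apply (hj : Function.Injective j) (f : inducedSpace j T h) :
    inducedNorm j T h hj f = ‖inducedMap j T h hj f‖ := rfl

end Induced

/-- A seminorm is a Banach norm: it is definite and complete. -/
def IsBanachNorm {V : Type*} [AddCommGroup V] [Module ℂ V] (p : Seminorm ℂ V) : Prop :=
  (∀ v, p v = 0 → v = 0) ∧
    ∀ u : ℕ → V, (∀ ε > 0, ∃ N, ∀ k ≥ N, ∀ l ≥ N, p (u k - u l) < ε) →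
      ∃ v, Tendsto (fun k => p (u k - v)) atTop (𝓝 0)

end ModulationSpaces

end

/-! The operator `M ∘ 𝕄⁻¹` is continuous on tempered distributions, so its restriction to the Banach
space `𝔏` has a closed graph; being bijective, it is an isomorphism `b` of `𝔏`
(`exists_restrict_equiv`). As `M(f ⊗ h)` is the image of `𝕄(f ⊗ h)` under `M ∘ 𝕄⁻¹`, membership in
`𝔏` passes from `𝕄` to `M`, and it passes back once `M` is injective; the two norms then differ by
`b`. For the invertible map `𝕄` completeness holds because `f ↦ f ⊗ h` has a continuous left
inverse, hence closed range; the equivalence of norms carries completeness over to `M`.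

The heart is therefore the injectivity of `M`, that is, of `N` (`modulation_injective`). `N` is the
transpose of a continuous map `T` on Schwartz functions of two variables, so it is enough that `T`
is onto (`exists_transpose_nMap`). Up to Fourier transformation of both variables, `T` is the map
`T₀` sending `a ⊗ b` to the kernel of `u ↦ a # u # b`. Parseval's identity turns the orthogonality
requirement into a trace formula: the trace of `u ↦ x # u # y` is a nonzero constant times `∫ x · ∫
y` (`exists_hasSum_trace`). With the cyclicity of `∫ f # g # h` this says that `T₀` followed by the
exchange of variables squares to a nonzero multiple of the identity, so `T₀` is onto.

The analytic work is to show that kernels and traces exist, with bounds. Regularity is only the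
qualitative inclusion `𝓢 # 𝓢' # 𝓢 ⊂ 𝓢`. Nuclearity of the Schwartz space enters as an explicit
expansion `f = ∑ ⟨ψ i, f⟩ φ i` with summable weights (`SchwartzFrame`), built from a Gabor expansion
on the line, products and linear changes of variables. The Banach-Steinhaus theorem on `ℓ¹`, applied
to the matrix coefficients of `u ↦ a # u # b` in this expansion, converts regularity into the
estimate `exists_sn_mul_mul_le`, from which every convergence statement about `#` follows. -/

noncomputable section

namespace ModulationSpaces

/-! ### A directed family of norms on Schwartz spaces -/

section Norms

variable {E F : Type*} [NormedAddCommGroup E] [NormedSpace ℝ E]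
  [NormedAddCommGroup F] [NormedSpace ℂ F]

/-- The increasing sequence of norms `sup_{k, n ≤ N} sup_x ‖x‖ ^ k ‖D ^ n f (x)‖` which defines the
topology of the Schwartz space. -/
def sn (N : ℕ) : Seminorm ℂ 𝓢(E, F) :=
  (Finset.Iic (N, N)).sup (schwartzSeminormFamily ℂ E F)

theorem seminorm_le_sn {k n N : ℕ} (hk : k ≤ N) (hn : n ≤ N) (f : 𝓢(E, F)) :
    SchwartzMap.seminorm ℂ k n f ≤ sn N f :=
  (Finset.le_sup (f := schwartzSeminormFamily ℂ E F)
    (Finset.mem_Iic.2 (show (k, n) ≤ (N, N) from ⟨hk, hn⟩)) : _) f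

theorem sn_le {N : ℕ} {f : 𝓢(E, F)} {M : ℝ} (hM : 0 ≤ M)
    (h : ∀ k ≤ N, ∀ n ≤ N, SchwartzMap.seminorm ℂ k n f ≤ M) : sn N f ≤ M := by
  refine Seminorm.finset_sup_apply_le hM fun m hm => ?_
  have hm' : m ≤ (N, N) := Finset.mem_Iic.1 hm
  exact h m.1 hm'.1 m.2 hm'.2

theorem sn_nonneg (N : ℕ) (f : 𝓢(E, F)) : 0 ≤ sn N f := apply_nonneg _ _

theorem sn_mono {N M : ℕ} (h : N ≤ M) (f : 𝓢(E, F)) : sn N f ≤ sn M f :=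
  sn_le (sn_nonneg _ _) fun _ hk _ hn => seminorm_le_sn (hk.trans h) (hn.trans h) f

theorem sn_continuous (N : ℕ) : Continuous (sn N : 𝓢(E, F) → ℝ) :=
  Seminorm.continuous_finsetSup (fun i _ => (schwartz_withSeminorms ℂ E F).continuous_seminorm i)

theorem norm_le_sn (N : ℕ) (f : 𝓢(E, F)) (x : E) : ‖f x‖ ≤ sn N f :=
  (f.norm_le_seminorm ℂ x).trans (seminorm_le_sn (Nat.zero_le _) (Nat.zero_le _) f)

theorem eq_zero_of_sn {N : ℕ} {f : 𝓢(E, F)} (h : sn N f = 0) : f = 0 := by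
  ext x
  simpa using (norm_le_sn N f x).trans h.le

theorem exists_finset_sup_le_sn (s : Finset (ℕ × ℕ)) :
    ∃ N, ∀ f : 𝓢(E, F), s.sup (schwartzSeminormFamily ℂ E F) f ≤ sn N f := by
  refine ⟨s.sup (fun m => max m.1 m.2), fun f => ?_⟩
  refine Seminorm.finset_sup_apply_le (sn_nonneg _ _) fun m hm => ?_
  have h := Finset.le_sup (f := fun m : ℕ × ℕ => max m.1 m.2) hm
  exact seminorm_le_sn ((le_max_left _ _).trans h) ((le_max_right _ _).trans h) f

theorem exists_le_sn_of_continuous {q : Seminorm ℂ 𝓢(E, F)} (hq : Continuous q) :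
    ∃ (K : ℕ) (C : ℝ), 0 ≤ C ∧ ∀ f, q f ≤ C * sn K f := by
  obtain ⟨s, C, -, h⟩ := Seminorm.bound_of_continuous (schwartz_withSeminorms ℂ E F) q hq
  obtain ⟨K, hK⟩ := exists_finset_sup_le_sn (E := E) (F := F) s
  refine ⟨K, C, C.2, fun f => (h f).trans ?_⟩
  exact mul_le_mul_of_nonneg_left (hK f) C.2

theorem exists_sn_map_le {E' F' : Type*} [NormedAddCommGroup E'] [NormedSpace ℝ E']
    [NormedAddCommGroup F'] [NormedSpace ℂ F'] (T : 𝓢(E, F) →L[ℂ] 𝓢(E', F')) (N : ℕ) :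
    ∃ (K : ℕ) (C : ℝ), 0 ≤ C ∧ ∀ f, sn N (T f) ≤ C * sn K f := by
  let q : Seminorm ℂ 𝓢(E, F) := (sn N).comp T.toLinearMap
  have hq : Continuous q := (sn_continuous N).comp T.continuous
  exact exists_le_sn_of_continuous hq

theorem exists_norm_le_sn (u : StrongDual ℂ 𝓢(E, F)) :
    ∃ (K : ℕ) (C : ℝ), 0 ≤ C ∧ ∀ f, ‖u f‖ ≤ C * sn K f :=
  exists_le_sn_of_continuous (q := (normSeminorm ℂ ℂ).comp u.toLinearMap)
    (continuous_norm.comp u.continuous)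

theorem continuous_of_sn_le {E' F' : Type*} [NormedAddCommGroup E'] [NormedSpace ℝ E']
    [NormedAddCommGroup F'] [NormedSpace ℂ F'] (T : 𝓢(E, F) →ₗ[ℂ] 𝓢(E', F'))
    (h : ∀ N, ∃ (K : ℕ) (C : ℝ), 0 ≤ C ∧ ∀ f, sn N (T f) ≤ C * sn K f) : Continuous T := by
  refine (schwartz_withSeminorms ℂ E' F').continuous_of_continuous_comp T fun m => ?_
  obtain ⟨K, C, hC, hT⟩ := h (max m.1 m.2)
  refine Seminorm.continuous_of_le
    (q := C.toNNReal • sn K) ((sn_continuous K).const_smul C.toNNReal) fun f => ?_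
  refine (seminorm_le_sn (le_max_left m.1 m.2) (le_max_right _ _) (T f)).trans ((hT f).trans ?_)
  simp [NNReal.smul_def, Real.coe_toNNReal C hC]

theorem tendsto_schwartz {ι : Type*} {l : Filter ι} {u : ι → 𝓢(E, F)} {v : 𝓢(E, F)}
    (h : ∀ N, Tendsto (fun i => sn N (u i - v)) l (𝓝 0)) : Tendsto u l (𝓝 v) := by
  rw [(schwartz_withSeminorms ℂ E F).tendsto_nhds]
  intro m ε hε
  filter_upwards [(h (max m.1 m.2)).eventually_lt_const hε] with i hi
  exact (seminorm_le_sn (le_max_left m.1 m.2) (le_max_right _ _) _).trans_lt hi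

/-- The derivatives of all orders converge uniformly, so the pointwise sum may be differentiated
termwise, and the weights `‖x‖ ^ k` pass inside the sum. -/
theorem exists_tsum_schwartz [CompleteSpace F] {ι : Type*} (f : ι → 𝓢(E, F))
    (hf : ∀ N, Summable fun i => sn N (f i)) :
    ∃ g : 𝓢(E, F), (∀ x, HasSum (fun i => f i x) (g x)) ∧ ∀ N, sn N g ≤ ∑' i, sn N (f i) := by
  have hb : ∀ (k n : ℕ), Summable fun i => SchwartzMap.seminorm ℂ k n (f i) := fun k n =>
    (hf (max k n)).of_nonneg_of_le (fun _ => apply_nonneg _ _)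
      fun i => seminorm_le_sn (le_max_left _ _) (le_max_right _ _) _
  have hpt : ∀ (k : ℕ) (i : ι) (x : E),
      ‖iteratedFDeriv ℝ k (f i) x‖ ≤ SchwartzMap.seminorm ℂ 0 k (f i) := fun k i x =>
    (f i).norm_iteratedFDeriv_le_seminorm ℂ k x
  have key : ∀ (k n : ℕ) (x : E),
      ‖x‖ ^ k * ‖iteratedFDeriv ℝ n (fun y => ∑' i, f i y) x‖ ≤
        ∑' i, SchwartzMap.seminorm ℂ k n (f i) := by
    intro k n x
    rw [iteratedFDeriv_tsum_apply (N := ⊤) (v := fun k i => SchwartzMap.seminorm ℂ 0 k (f i))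
      (fun i => (f i).smooth ⊤) (fun k _ => hb 0 k) (fun k i x _ => hpt k i x) le_top]
    have hs : Summable fun i => ‖iteratedFDeriv ℝ n (f i) x‖ :=
      (hb 0 n).of_nonneg_of_le (fun _ => norm_nonneg _) fun i => hpt n i x
    calc _ ≤ ‖x‖ ^ k * ∑' i, ‖iteratedFDeriv ℝ n (f i) x‖ := by
          gcongr; exact norm_tsum_le_tsum_norm hs
      _ = ∑' i, ‖x‖ ^ k * ‖iteratedFDeriv ℝ n (f i) x‖ := tsum_mul_left.symm
      _ ≤ _ := (hs.mul_left _).tsum_le_tsum (fun i => (f i).le_seminorm ℂ k n x) (hb k n)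
  have hsm : ContDiff ℝ ((⊤ : ℕ∞) : WithTop ℕ∞) (fun y => ∑' i, f i y) :=
    contDiff_tsum (N := ⊤) (v := fun k i => SchwartzMap.seminorm ℂ 0 k (f i))
      (fun i => (f i).smooth ⊤) (fun k _ => hb 0 k) (fun k i x _ => hpt k i x)
  obtain ⟨g, hg⟩ : ∃ g : 𝓢(E, F), ⇑g = fun y => ∑' i, f i y :=
    ⟨⟨fun y => ∑' i, f i y, hsm, fun k n => ⟨_, key k n⟩⟩, rfl⟩
  refine ⟨g, fun x => ?_, fun N => ?_⟩
  · have hsum : Summable fun i => f i x :=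
      .of_norm ((hf 0).of_nonneg_of_le (fun _ => norm_nonneg _) fun i => norm_le_sn 0 _ x)
    rw [hg]
    exact hsum.hasSum
  · refine sn_le (tsum_nonneg fun _ => sn_nonneg _ _) fun k hk n hn => ?_
    have h1 : SchwartzMap.seminorm ℂ k n g ≤ ∑' i, SchwartzMap.seminorm ℂ k n (f i) :=
      g.seminorm_le_bound ℂ k n (tsum_nonneg fun _ => apply_nonneg _ _) (by rw [hg]; exact key k n)
    refine h1.trans ?_
    exact (hb k n).tsum_le_tsum (fun i => seminorm_le_sn hk hn _) (hf N)

/-- Absolutely convergent series of Schwartz functions converge. -/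
theorem exists_hasSum_schwartz [CompleteSpace F] {ι : Type*} (f : ι → 𝓢(E, F))
    (hf : ∀ N, Summable fun i => sn N (f i)) :
    ∃ g : 𝓢(E, F), HasSum f g ∧ (∀ x, HasSum (fun i => f i x) (g x)) ∧
      ∀ N, sn N g ≤ ∑' i, sn N (f i) := by
  obtain ⟨g, hg, hb⟩ := exists_tsum_schwartz f hf
  refine ⟨g, tendsto_schwartz fun N => ?_, hg, hb⟩
  have ht := tendsto_tsum_compl_atTop_zero (fun i => sn N (f i))
  refine squeeze_zero (fun _ => sn_nonneg _ _) (fun s => ?_) ht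
  obtain ⟨g', hg', hb'⟩ := exists_tsum_schwartz (fun i : {i // i ∉ s} => f i)
    fun N => (hf N).subtype {i | i ∉ s}
  have e : ∑ i ∈ s, f i - g = -g' := by
    ext x
    have h1 := (hg x).summable.sum_add_tsum_compl (s := s)
    have h3 : (∑ i ∈ s, f i - g) x = ∑ i ∈ s, f i x - g x := by simp
    have h4 : (-g') x = -g' x := rfl
    have h5 : ∑' i : ((s : Set ι)ᶜ : Set ι), f i x = g' x := (hg' x).tsum_eq
    rw [h3, h4, ← (hg x).tsum_eq, ← h1, h5]
    abel
  rw [e, map_neg_eq_map]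
  exact hb' N

theorem sn_le_tsum {ι : Type*} {f : ι → 𝓢(E, F)} {g : 𝓢(E, F)} (h : HasSum f g) {N : ℕ}
    (hf : Summable fun i => sn N (f i)) : sn N g ≤ ∑' i, sn N (f i) :=
  le_of_tendsto (((sn_continuous N).tendsto g).comp h) (Eventually.of_forall fun s =>
    (Finset.le_sum_of_subadditive _ (map_zero (sn N)).le (map_add_le_add (sn N)) s f).trans
      (hf.sum_le_tsum s fun _ _ => sn_nonneg _ _))

/-- Absolute convergence already provides a limit in the Schwartz topology; pointwise values only
have to identify it. -/
theorem hasSum_schwartz_of_apply [CompleteSpace F] {ι : Type*} {f : ι → 𝓢(E, F)} {g : 𝓢(E, F)}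
    (hf : ∀ N, Summable fun i => sn N (f i)) (h : ∀ x, HasSum (fun i => f i x) (g x)) :
    HasSum f g := by
  obtain ⟨g', h1, h2, -⟩ := exists_hasSum_schwartz f hf
  have : g' = g := by ext x; exact (h2 x).unique (h x)
  exact this ▸ h1

/-- A series of linear maps of Schwartz spaces with summable bounds converges pointwise to a
continuous linear map. -/
theorem exists_hasSum_clm {E' F' : Type*} [NormedAddCommGroup E'] [NormedSpace ℝ E']
    [NormedAddCommGroup F'] [NormedSpace ℂ F'] [CompleteSpace F'] {ι : Type*}
    (T : ι → 𝓢(E, F) →ₗ[ℂ] 𝓢(E', F')) {w : ι → ℝ} (hw : Summable w)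
    (h : ∀ N, ∃ (K : ℕ) (C : ℝ), 0 ≤ C ∧ ∀ i f, sn N (T i f) ≤ C * w i * sn K f) :
    ∃ S : 𝓢(E, F) →L[ℂ] 𝓢(E', F'), ∀ f, HasSum (fun i => T i f) (S f) := by
  have hs : ∀ f N, Summable fun i => sn N (T i f) := fun f N => by
    obtain ⟨K, C, hC, hT⟩ := h N
    exact ((hw.mul_left C).mul_right (sn K f)).of_nonneg_of_le (fun _ => sn_nonneg _ _)
      fun i => hT i f
  choose S hS _ hb using fun f => exists_hasSum_schwartz (fun i => T i f) (hs f)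
  let S' : 𝓢(E, F) →ₗ[ℂ] 𝓢(E', F') :=
    { toFun := S
      map_add' := fun f g => (hS (f + g)).unique (by simpa using (hS f).add (hS g))
      map_smul' := fun c f => (hS (c • f)).unique (by simpa using (hS f).const_smul c) }
  refine ⟨⟨S', continuous_of_sn_le S' fun N => ?_⟩, hS⟩
  obtain ⟨K, C, hC, hT⟩ := h N
  refine ⟨K, |C * ∑' i, w i|, abs_nonneg _, fun f => ?_⟩
  refine (hb f N).trans (((hs f N).tsum_le_tsum (fun i => hT i f)
    ((hw.mul_left C).mul_right _)).trans ?_)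
  rw [tsum_mul_right, tsum_mul_left]
  exact mul_le_mul_of_nonneg_right (le_abs_self _) (sn_nonneg _ _)

end Norms

/-- A series of tempered distributions with summable bounds converges in the strong topology. -/
theorem hasSum_tempered {E : Type*} [NormedAddCommGroup E] [NormedSpace ℝ E] {ι : Type*}
    {v : ι → Tempered E} {u : Tempered E} {w : ι → ℝ} (hw : Summable w) (hw0 : ∀ i, 0 ≤ w i)
    {K : ℕ}     (hv : ∀ i f, ‖v i f‖ ≤ w i * sn K f) (h : ∀ f, HasSum (fun i => v i f) (u f)) :
    HasSum v u := by
  have hB := ContinuousLinearMap.hasBasis_nhds_zero_of_basis (𝕜₁ := ℂ) (𝕜₂ := ℂ) (σ := RingHom.id ℂ)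
    (E := 𝓢(E, ℂ)) (F := ℂ) Metric.nhds_basis_ball
  rw [HasSum, ← tendsto_sub_nhds_zero_iff, hB.tendsto_right_iff]
  rintro ⟨B, ε⟩ ⟨hB, hε⟩
  -- A bounded set is bounded for the single norm `sn K`, which makes the tail estimate uniform on
  -- it; this is convergence in the strong topology.
  obtain ⟨r, hr0, hr⟩ : ∃ r, 0 ≤ r ∧ ∀ f ∈ B, sn K f ≤ r := by
    have h1 := (schwartz_withSeminorms ℂ E ℂ).isVonNBounded_iff_finset_seminorm_bounded.1 hB
      (Finset.Iic (K, K))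
    obtain ⟨r, hr, h2⟩ := h1
    exact ⟨r, hr.le, fun f hf => (h2 f hf).le⟩
  have ht := (tendsto_tsum_compl_atTop_zero w).mul_const r
  rw [zero_mul] at ht
  filter_upwards [ht.eventually_lt_const hε] with s hs f hf
  rw [mem_ball_zero_iff]
  have e : (∑ i ∈ s, v i - u) f = -∑' i : {i // i ∉ s}, v i f := by
    have h1 := (h f).summable.sum_add_tsum_compl (s := s)
    rw [(h f).tsum_eq] at h1
    have h3 : (∑ i ∈ s, v i - u) f = ∑ i ∈ s, v i f - u f := by simp
    have h4 : ∑' i : {i // i ∉ s}, v i f = ∑' i : ((s : Set ι)ᶜ : Set ι), v i f := rfl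
    rw [h3, h4, ← h1]; abel
  rw [e, norm_neg]
  refine lt_of_le_of_lt ?_ hs
  have hsw : Summable fun i : {i // i ∉ s} => w i := hw.subtype {i | i ∉ s}
  refine (tsum_of_norm_bounded (hsw.hasSum.mul_right (sn K f)) fun i => hv i f).trans ?_
  refine mul_le_mul_of_nonneg_left (hr f hf) ?_
  exact tsum_nonneg fun i => hw0 _

end ModulationSpaces

/-! ### Uniform boundedness on `ℓ¹` -/

namespace ModulationSpaces

theorem hasSum_of_eq {ι V : Type*} [AddCommMonoid V] [TopologicalSpace V] {f g : ι → V} {a b : V}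
    (h : HasSum f a) (e : ∀ i, f i = g i) (hab : a = b) : HasSum g b := by
  obtain rfl : f = g := funext e
  exact hab ▸ h

/-- The uniform boundedness principle on `ℓ¹`, for functionals given by the rows of a matrix. -/
theorem exists_bound_of_l1_bounded {Λ ι : Type*} (t : Λ → ι → ℂ)
    (hrow : ∀ a, ∃ C, ∀ i, ‖t a i‖ ≤ C)
    (h : ∀ c : ι → ℂ, Summable (fun i => ‖c i‖) → ∃ C, ∀ a, ‖∑' i, c i * t a i‖ ≤ C) :
    ∃ C, ∀ a i, ‖t a i‖ ≤ C := by
  classical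
  have hs : ∀ c : lp (fun _ : ι => ℂ) 1, Summable fun i => ‖c i‖ := fun c => by
    simpa using (memℓp_gen_iff (p := 1) (by simp)).1 (lp.memℓp c)
  have hn : ∀ c : lp (fun _ : ι => ℂ) 1, ‖c‖ = ∑' i, ‖c i‖ := fun c => by
    simpa using lp.norm_eq_tsum_rpow (p := 1) (by simp) c
  choose C hC using hrow
  have hsum : ∀ a (c : lp (fun _ : ι => ℂ) 1), Summable fun i => ‖c i * t a i‖ := fun a c => by
    refine ((hs c).mul_right (C a)).of_nonneg_of_le (fun _ => norm_nonneg _) fun i => ?_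
    rw [norm_mul]
    exact mul_le_mul_of_nonneg_left (hC a i) (norm_nonneg _)
  let T : Λ → lp (fun _ : ι => ℂ) 1 →L[ℂ] ℂ := fun a => LinearMap.mkContinuous
    { toFun := fun c => ∑' i, c i * t a i
      map_add' := fun c d => by
        rw [← (hsum a c).of_norm.tsum_add (hsum a d).of_norm]
        exact tsum_congr fun i => by simp [add_mul]
      map_smul' := fun r c => by
        rw [RingHom.id_apply, smul_eq_mul, ← tsum_mul_left]
        exact tsum_congr fun i => by simp [mul_assoc] } (C a) fun c => by
        refine (norm_tsum_le_tsum_norm (hsum a c)).trans ?_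
        rw [hn, ← tsum_mul_left]
        refine (hsum a c).tsum_le_tsum (fun i => ?_) ((hs c).mul_left _)
        rw [norm_mul, mul_comm]
        exact mul_le_mul_of_nonneg_right (hC a i) (norm_nonneg _)
  obtain ⟨B, hB⟩ := banach_steinhaus (g := T) fun c => h c (hs c)
  refine ⟨B, fun a i => ?_⟩
  -- Evaluation at the unit vectors of `ℓ¹`, which have norm one, recovers the matrix entries.
  have h1 := (T a).le_opNorm (lp.single 1 i (1 : ℂ))
  rw [lp.norm_single (by simp), norm_one, mul_one] at h1
  refine le_trans (le_of_eq ?_) (h1.trans (hB a))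
  congr 1
  change t a i = ∑' j, (lp.single 1 i (1 : ℂ) : ∀ _ : ι, ℂ) j * t a j
  rw [tsum_eq_single i fun j hj => by simp [hj]]
  simp

end ModulationSpaces

namespace ModulationSpaces

/-! ### Tensor products, slices and contractions -/

section TensorBounds

variable {E F : Type} [NormedAddCommGroup E] [NormedSpace ℝ E]
  [NormedAddCommGroup F] [NormedSpace ℝ F]

/-- The Leibniz rule: the binomial coefficients contribute `2 ^ N`, and splitting `‖z‖ ^ k` between
the two variables contributes another factor 2. -/
theorem sn_tensor_le (N : ℕ) (f : 𝓢(E, ℂ)) (g : 𝓢(F, ℂ)) :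
    sn N (tensor f g) ≤ 2 ^ (N + 1) * sn N f * sn N g := by
  have hnn : 0 ≤ sn N f * sn N g := mul_nonneg (sn_nonneg _ _) (sn_nonneg _ _)
  refine sn_le (by rw [mul_assoc]; positivity) fun k hk n hn => ?_
  refine SchwartzMap.seminorm_le_bound ℂ k n _ (by rw [mul_assoc]; positivity) fun z => ?_
  have hf : ContDiff ℝ n (fun z : E × F => f z.1) := (f.smooth n).comp contDiff_fst
  have hg : ContDiff ℝ n (fun z : E × F => g z.2) := (g.smooth n).comp contDiff_snd
  have h1 : ∀ (i : ℕ) (z : E × F),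
      ‖iteratedFDeriv ℝ i (fun z : E × F => f z.1) z‖ ≤ ‖iteratedFDeriv ℝ i f z.1‖ := by
    intro i z
    have := (ContinuousLinearMap.fst ℝ E F).iteratedFDeriv_comp_right (f.smooth i) z le_rfl
    have e : (fun z : E × F => f z.1) = f ∘ (ContinuousLinearMap.fst ℝ E F) := rfl
    rw [e, this]
    refine (ContinuousMultilinearMap.norm_compContinuousLinearMap_le _ _).trans ?_
    refine mul_le_of_le_one_right (norm_nonneg _) ?_
    exact Finset.prod_le_one (fun _ _ => norm_nonneg _)
      (fun _ _ => ContinuousLinearMap.norm_fst_le ℝ E F)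
  have h2 : ∀ (i : ℕ) (z : E × F),
      ‖iteratedFDeriv ℝ i (fun z : E × F => g z.2) z‖ ≤ ‖iteratedFDeriv ℝ i g z.2‖ := by
    intro i z
    have := (ContinuousLinearMap.snd ℝ E F).iteratedFDeriv_comp_right (g.smooth i) z le_rfl
    have e : (fun z : E × F => g z.2) = g ∘ (ContinuousLinearMap.snd ℝ E F) := rfl
    rw [e, this]
    refine (ContinuousMultilinearMap.norm_compContinuousLinearMap_le _ _).trans ?_
    refine mul_le_of_le_one_right (norm_nonneg _) ?_
    exact Finset.prod_le_one (fun _ _ => norm_nonneg _)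
      (fun _ _ => ContinuousLinearMap.norm_snd_le ℝ E F)
  have hm := norm_iteratedFDeriv_mul_le hf hg z (n := n) le_rfl
  have hz : ‖z‖ ^ k ≤ ‖z.1‖ ^ k + ‖z.2‖ ^ k := by
    rcases le_total ‖z.1‖ ‖z.2‖ with h | h
    · rw [Prod.norm_def, max_eq_right h]; exact le_add_of_nonneg_left (by positivity)
    · rw [Prod.norm_def, max_eq_left h]; exact le_add_of_nonneg_right (by positivity)
  have ha : ∀ l ≤ N, ∀ i ≤ N, ‖z.1‖ ^ l * ‖iteratedFDeriv ℝ i f z.1‖ ≤ sn N f := fun l hl i hi =>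
    (f.le_seminorm ℂ l i z.1).trans (seminorm_le_sn hl hi f)
  have hb : ∀ l ≤ N, ∀ i ≤ N, ‖z.2‖ ^ l * ‖iteratedFDeriv ℝ i g z.2‖ ≤ sn N g := fun l hl i hi =>
    (g.le_seminorm ℂ l i z.2).trans (seminorm_le_sn hl hi g)
  have hterm : ∀ i ∈ Finset.range (n + 1), ‖z‖ ^ k * ((n.choose i : ℝ) *
      ‖iteratedFDeriv ℝ i (fun z : E × F => f z.1) z‖ *
        ‖iteratedFDeriv ℝ (n - i) (fun z : E × F => g z.2) z‖) ≤
      (n.choose i : ℝ) * (2 * (sn N f * sn N g)) := by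
    intro i hi
    have hiN : i ≤ N := (Nat.lt_succ_iff.1 (Finset.mem_range.1 hi)).trans hn
    have hiN' : n - i ≤ N := (Nat.sub_le _ _).trans hn
    have a1 := ha k hk i hiN
    have a2 := ha 0 (Nat.zero_le _) i hiN
    have b1 := hb k hk _ hiN'
    have b2 := hb 0 (Nat.zero_le _) _ hiN'
    rw [pow_zero, one_mul] at a2 b2
    calc ‖z‖ ^ k * ((n.choose i : ℝ) * ‖iteratedFDeriv ℝ i (fun z : E × F => f z.1) z‖ *
          ‖iteratedFDeriv ℝ (n - i) (fun z : E × F => g z.2) z‖)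
        ≤ (‖z.1‖ ^ k + ‖z.2‖ ^ k) * ((n.choose i : ℝ) * ‖iteratedFDeriv ℝ i f z.1‖ *
          ‖iteratedFDeriv ℝ (n - i) g z.2‖) := by
          gcongr
          · exact h1 i z
          · exact h2 (n - i) z
      _ = (n.choose i : ℝ) * ((‖z.1‖ ^ k * ‖iteratedFDeriv ℝ i f z.1‖) *
            ‖iteratedFDeriv ℝ (n - i) g z.2‖ +
            ‖iteratedFDeriv ℝ i f z.1‖ * (‖z.2‖ ^ k * ‖iteratedFDeriv ℝ (n - i) g z.2‖)) := by
          ring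
      _ ≤ (n.choose i : ℝ) * (sn N f * sn N g + sn N f * sn N g) := by
          gcongr
      _ = _ := by ring
  refine (mul_le_mul_of_nonneg_left hm (by positivity)).trans ?_
  rw [Finset.mul_sum]
  refine (Finset.sum_le_sum hterm).trans ?_
  rw [← Finset.sum_mul]
  have hc : (∑ i ∈ Finset.range (n + 1), (n.choose i : ℝ)) ≤ 2 ^ N := by
    have := Nat.sum_range_choose n
    calc (∑ i ∈ Finset.range (n + 1), (n.choose i : ℝ)) = 2 ^ n := by exact_mod_cast this
      _ ≤ 2 ^ N := by gcongr; norm_num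
  calc _ ≤ 2 ^ N * (2 * (sn N f * sn N g)) := by gcongr
    _ = _ := by ring

/-- The elementary tensor as a bilinear map. -/
def tensorL : 𝓢(E, ℂ) →ₗ[ℂ] 𝓢(F, ℂ) →ₗ[ℂ] 𝓢(E × F, ℂ) :=
  LinearMap.mk₂ ℂ tensor (fun f g h => by ext z; simp [add_mul])
    (fun c f g => by ext z; simp [mul_assoc]) (fun f g h => by ext z; simp [mul_add])
    (fun c f g => by ext z; simp [mul_left_comm])

@[simp] theorem tensorL_apply (f : 𝓢(E, ℂ)) (g : 𝓢(F, ℂ)) : tensorL f g = tensor f g := rfl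

/-- The continuous linear map `f ↦ f ⊗ g`. -/
def tensorRight (g : 𝓢(F, ℂ)) : 𝓢(E, ℂ) →L[ℂ] 𝓢(E × F, ℂ) :=
  ⟨tensorL.flip g, continuous_of_sn_le _ fun N => ⟨N, 2 ^ (N + 1) * sn N g,
    mul_nonneg (by positivity) (sn_nonneg _ _), fun f => (sn_tensor_le N f g).trans_eq (by ring)⟩⟩

/-- The continuous linear map `g ↦ f ⊗ g`. -/
def tensorLeft (f : 𝓢(E, ℂ)) : 𝓢(F, ℂ) →L[ℂ] 𝓢(E × F, ℂ) :=
  ⟨tensorL f, continuous_of_sn_le _ fun N => ⟨N, 2 ^ (N + 1) * sn N f,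
    mul_nonneg (by positivity) (sn_nonneg _ _), fun g => sn_tensor_le N f g⟩⟩

variable {G : Type} [NormedAddCommGroup G] [NormedSpace ℂ G]

theorem slice_decay (Φ : 𝓢(E × F, G)) (x : E) (m k n : ℕ) (y : F) :
    ‖x‖ ^ m * (‖y‖ ^ k * ‖iteratedFDeriv ℝ n (fun y => Φ (x, y)) y‖) ≤
      SchwartzMap.seminorm ℂ (m + k) n Φ := by
  have e : (fun y => Φ (x, y)) = (fun z => Φ ((x, 0) + z)) ∘ (ContinuousLinearMap.inr ℝ E F) := by
    ext y; simp
  have hs : ContDiff ℝ n (fun z => Φ ((x, 0) + z)) :=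
    (Φ.smooth n).comp (contDiff_const.add contDiff_id)
  have h1 : ‖iteratedFDeriv ℝ n (fun y => Φ (x, y)) y‖ ≤ ‖iteratedFDeriv ℝ n Φ (x, y)‖ := by
    rw [e, (ContinuousLinearMap.inr ℝ E F).iteratedFDeriv_comp_right hs y le_rfl,
      iteratedFDeriv_comp_add_left]
    refine (ContinuousMultilinearMap.norm_compContinuousLinearMap_le _ _).trans ?_
    have e2 : ((x, 0) + (ContinuousLinearMap.inr ℝ E F) y : E × F) = (x, y) := by simp
    rw [e2]
    refine mul_le_of_le_one_right (norm_nonneg _) ?_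
    exact Finset.prod_le_one (fun _ _ => norm_nonneg _)
      (fun _ _ => ContinuousLinearMap.norm_inr_le_one ℝ E F)
  refine le_trans ?_ (Φ.le_seminorm ℂ (m + k) n (x, y))
  calc _ ≤ ‖(x, y)‖ ^ m * (‖(x, y)‖ ^ k * ‖iteratedFDeriv ℝ n Φ (x, y)‖) := by
        gcongr
        · exact norm_fst_le (x, y)
        · exact norm_snd_le (x, y)
    _ = _ := by ring

/-- The slice `y ↦ Φ (x, y)` of a Schwartz function. -/
def slice (Φ : 𝓢(E × F, G)) (x : E) : 𝓢(F, G) where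
  toFun y := Φ (x, y)
  smooth' := (Φ.smooth _).comp (contDiff_const.prodMk contDiff_id)
  decay' k n := ⟨SchwartzMap.seminorm ℂ k n Φ, fun y => by
    simpa using slice_decay Φ x 0 k n y⟩

@[simp] theorem slice_apply (Φ : 𝓢(E × F, G)) (x : E) (y : F) : slice Φ x y = Φ (x, y) := rfl

theorem sn_slice_le (Φ : 𝓢(E × F, G)) (x : E) (m N : ℕ) :
    ‖x‖ ^ m * sn N (slice Φ x) ≤ sn (m + N) Φ := by
  rcases eq_or_ne (‖x‖ ^ m) 0 with h0 | h0
  · rw [h0, zero_mul]; exact sn_nonneg _ _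
  have hpos : 0 < ‖x‖ ^ m := lt_of_le_of_ne (by positivity) (Ne.symm h0)
  rw [← le_div_iff₀' hpos]
  refine sn_le (div_nonneg (sn_nonneg _ _) hpos.le) fun k hk n hn => ?_
  refine (slice Φ x).seminorm_le_bound ℂ k n (div_nonneg (sn_nonneg _ _) hpos.le) fun y => ?_
  rw [le_div_iff₀' hpos]
  exact (slice_decay Φ x m k n y).trans (seminorm_le_sn (by omega) (by omega) Φ)

theorem sn_partialFst_le (N : ℕ) (Φ : 𝓢(E × F, G)) : sn N (partialFst Φ) ≤ sn (N + 1) Φ :=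
  sn_le (sn_nonneg _ _) fun k hk n hn =>
    (seminorm_partialFst_le Φ k n).trans (seminorm_le_sn (k := k) (n := n + 1)
      (by omega) (by omega) Φ)

variable [MeasurableSpace F] [BorelSpace F] [SecondCountableTopology F]
  (μ : Measure F) [μ.HasTemperateGrowth]

/-- A norming functional of the vector-valued integral reduces to the scalar case. Vector values are
needed because partial derivatives of a scalar function take values in spaces of linear maps. The
factor `B` stands for a norm of a synthesizing function and may vanish, so it is never divided out
here. -/
theorem norm_integral_smul_le [CompleteSpace G] (ψ : 𝓢(F, ℂ)) {B C : ℝ} {K : ℕ}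
    (hC : 0 ≤ C) (h : ∀ f : 𝓢(F, ℂ), ‖∫ y, ψ y * f y ∂μ‖ * B ≤ C * sn K f) (f : 𝓢(F, G)) :
    ‖∫ y, ψ y • f y ∂μ‖ * B ≤ C * sn K f := by
  obtain ⟨l, hl, hl'⟩ := exists_dual_vector'' ℂ (∫ y, ψ y • f y ∂μ)
  have hint : Integrable (fun y => ψ y • f y) μ := by
    refine ((ψ.integrable (μ := μ)).norm.mul_const (sn 0 f)).mono'
      (ψ.continuous.smul f.continuous).aestronglyMeasurable (Eventually.of_forall fun y => ?_)
    rw [norm_smul]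
    exact mul_le_mul_of_nonneg_left (norm_le_sn 0 f y) (norm_nonneg _)
  have h1 : ‖∫ y, ψ y • f y ∂μ‖ = ‖∫ y, ψ y * (f.postcompCLM l) y ∂μ‖ := by
    have : ∫ y, ψ y * (f.postcompCLM l) y ∂μ = l (∫ y, ψ y • f y ∂μ) := by
      rw [← l.integral_comp_comm hint]
      simp
    rw [this, hl']; simp
  rw [h1]
  refine (h _).trans (mul_le_mul_of_nonneg_left ?_ hC)
  refine sn_le (sn_nonneg _ _) fun k hk n hn => ?_
  refine (f.postcompCLM l).seminorm_le_bound ℂ k n (sn_nonneg _ _) fun y => ?_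
  refine le_trans ?_ ((f.le_seminorm ℂ k n y).trans (seminorm_le_sn hk hn f))
  gcongr
  have e : (f.postcompCLM l : F → ℂ) = (l.restrictScalars ℝ) ∘ f := rfl
  rw [e, (l.restrictScalars ℝ).iteratedFDeriv_comp_left (f.smooth n).contDiffAt le_rfl]
  refine (ContinuousLinearMap.norm_compContinuousMultilinearMap_le _ _).trans ?_
  refine mul_le_of_le_one_left (norm_nonneg _) ?_
  simpa using hl

end TensorBounds

section ContractBounds

variable {E F : Type} [NormedAddCommGroup E] [NormedSpace ℝ E]
  [NormedAddCommGroup F] [NormedSpace ℝ F]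
  [MeasurableSpace F] [BorelSpace F] [SecondCountableTopology F]
  (μ : Measure F) [μ.HasTemperateGrowth]

/-- Differentiation under the integral sign reduces the order by one at the price of one index of
`sn`; at order zero the hypothesis is applied to slices, and the weight `‖x‖ ^ k` costs `k` further
indices. -/
theorem decay_partialIntegral_of_bound (ψ : 𝓢(F, ℂ)) {B C : ℝ} {K : ℕ} (hC : 0 ≤ C)
    (h : ∀ f : 𝓢(F, ℂ), ‖∫ y, ψ y * f y ∂μ‖ * B ≤ C * sn K f) (k n : ℕ) :
    ∀ {G : Type} [NormedAddCommGroup G] [NormedSpace ℂ G] [CompleteSpace G] (Φ : 𝓢(E × F, G))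
      (x : E), ‖x‖ ^ k * ‖iteratedFDeriv ℝ n (partialIntegral μ ψ Φ) x‖ * B ≤
        C * sn (k + K + n) Φ := by
  induction n with
  | zero =>
    intro G _ _ _ Φ x
    rw [norm_iteratedFDeriv_zero, mul_assoc]
    have h1 := norm_integral_smul_le μ ψ hC h (slice Φ x)
    calc _ ≤ ‖x‖ ^ k * (C * sn K (slice Φ x)) := mul_le_mul_of_nonneg_left h1 (by positivity)
      _ = C * (‖x‖ ^ k * sn K (slice Φ x)) := by ring
      _ ≤ _ := by gcongr; exact sn_slice_le Φ x k K
  | succ n ih =>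
    intro G _ _ _ Φ x
    rw [← norm_iteratedFDeriv_fderiv, fderiv_partialIntegral]
    refine (ih _ x).trans ?_
    gcongr
    exact sn_partialFst_le _ Φ

theorem sn_contractSnd_le (ψ : 𝓢(F, ℂ)) {B C : ℝ} {K : ℕ} (hB : 0 ≤ B) (hC : 0 ≤ C)
    (h : ∀ f : 𝓢(F, ℂ), ‖∫ y, ψ y * f y ∂μ‖ * B ≤ C * sn K f) (N : ℕ) (Φ : 𝓢(E × F, ℂ)) :
    sn N (contractSnd μ ψ Φ) * B ≤ C * sn (N + K + N) Φ := by
  rcases hB.eq_or_lt with rfl | hB'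
  · rw [mul_zero]; exact mul_nonneg hC (sn_nonneg _ _)
  have h0 : 0 ≤ C * sn (N + K + N) Φ / B := div_nonneg (mul_nonneg hC (sn_nonneg _ _)) hB
  rw [← le_div_iff₀ hB']
  refine sn_le h0 fun k hk n hn => ?_
  refine SchwartzMap.seminorm_le_bound ℂ k n _ h0 fun x => ?_
  rw [le_div_iff₀ hB']
  refine (decay_partialIntegral_of_bound μ ψ hC h k n Φ x).trans ?_
  gcongr
  exact sn_mono (by omega) Φ

end ContractBounds

end ModulationSpaces

namespace ModulationSpaces

/-! ### Nuclear expansions of Schwartz functions -/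

/-- A nuclear expansion of the Schwartz space on `E`: Schwartz functions `φ i`, `ψ i` such that
`f = ∑ i, (∫ ψ i f) φ i` for all `f`, with summable bounds in each norm. -/
structure SchwartzFrame (E : Type) [NormedAddCommGroup E] [NormedSpace ℝ E] [MeasurableSpace E]
    (μ : Measure E) where
  /-- The index set. -/
  ι : Type
  /-- The synthesizing functions. -/
  φ : ι → 𝓢(E, ℂ)
  /-- The analysing functions. -/
  ψ : ι → 𝓢(E, ℂ)
  /-- The summable weight. -/
  w : ι → ℝ
  w_pos : ∀ i, 0 < w i
  summable_w : Summable w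
  expand : ∀ (f : 𝓢(E, ℂ)) (x : E), HasSum (fun i => (∫ y, ψ i y * f y ∂μ) * φ i x) (f x)
  bound : ∀ N, ∃ (K : ℕ) (C : ℝ), 0 ≤ C ∧
    ∀ i f, ‖∫ y, ψ i y * f y ∂μ‖ * sn N (φ i) ≤ C * w i * sn K f

namespace SchwartzFrame

section Basic

variable {E : Type} [NormedAddCommGroup E] [NormedSpace ℝ E] [MeasurableSpace E]
  {μ : Measure E} (A : SchwartzFrame E μ)

theorem summable_sn (f : 𝓢(E, ℂ)) (N : ℕ) :
    Summable fun i => sn N ((∫ y, A.ψ i y * f y ∂μ) • A.φ i) := by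
  obtain ⟨K, C, hC, h⟩ := A.bound N
  refine ((A.summable_w.mul_left C).mul_right (sn K f)).of_nonneg_of_le (fun _ => sn_nonneg _ _)
    fun i => ?_
  rw [map_smul_eq_mul]
  exact h i f

theorem hasSum (f : 𝓢(E, ℂ)) : HasSum (fun i => (∫ y, A.ψ i y * f y ∂μ) • A.φ i) f :=
  hasSum_schwartz_of_apply (A.summable_sn f) (A.expand f)

end Basic

section Product

variable {E F : Type} [NormedAddCommGroup E] [NormedSpace ℝ E]
  [NormedAddCommGroup F] [NormedSpace ℝ F]
  [MeasurableSpace F] [BorelSpace F] [SecondCountableTopology F]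
  {μ : Measure F} [μ.HasTemperateGrowth] (A : SchwartzFrame F μ)

/-- Smallness comes from the analysing function alone, so the weight `A.w i` survives for any choice
of norms on the contraction and on `A.φ i`. This makes expansions in elementary tensors converge
absolutely under bounded bilinear maps. -/
theorem contract_bound (N M : ℕ) : ∃ (K : ℕ) (C : ℝ), 0 ≤ C ∧ ∀ i (Φ : 𝓢(E × F, ℂ)),
    sn N (contractSnd μ (A.ψ i) Φ) * sn M (A.φ i) ≤ C * A.w i * sn K Φ := by
  obtain ⟨K, C, hC, h⟩ := A.bound M
  exact ⟨N + K + N, C, hC, fun i Φ => sn_contractSnd_le μ (A.ψ i) (sn_nonneg _ _)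
    (mul_nonneg hC (A.w_pos i).le) (h i) N Φ⟩

theorem hasSum_tensor (Φ : 𝓢(E × F, ℂ)) :
    HasSum (fun i => tensor (contractSnd μ (A.ψ i) Φ) (A.φ i)) Φ := by
  refine hasSum_schwartz_of_apply (fun N => ?_) fun z => ?_
  · obtain ⟨K, C, hC, h⟩ := A.contract_bound (E := E) N N
    refine ((A.summable_w.mul_left (2 ^ (N + 1) * C)).mul_right (sn K Φ)).of_nonneg_of_le
      (fun _ => sn_nonneg _ _) fun i => (sn_tensor_le N _ _).trans ?_
    calc _ = 2 ^ (N + 1) * (sn N (contractSnd μ (A.ψ i) Φ) * sn N (A.φ i)) := by ring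
      _ ≤ 2 ^ (N + 1) * (C * A.w i * sn K Φ) :=
          mul_le_mul_of_nonneg_left (h i Φ) (by positivity)
      _ = _ := by ring
  · exact A.expand (slice Φ z.1) z.2

theorem contractSnd_tensor (h : 𝓢(F, ℂ)) (f : 𝓢(E, ℂ)) (g : 𝓢(F, ℂ)) :
    contractSnd μ h (tensor f g) = (∫ y, h y * g y ∂μ) • f := by
  ext x
  rw [contractSnd_apply, smul_apply, smul_eq_mul, mul_comm, ← integral_const_mul]
  exact integral_congr_ae (Eventually.of_forall fun y => by simp [mul_left_comm])

/-- Bounded bilinear maps on Schwartz spaces extend to the Schwartz space of the product. -/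
theorem exists_extension (A : SchwartzFrame F μ) {G : Type} [NormedAddCommGroup G] [NormedSpace ℝ G]
    (β : 𝓢(E, ℂ) →ₗ[ℂ] 𝓢(F, ℂ) →ₗ[ℂ] 𝓢(G, ℂ))
    (hβ : ∀ N, ∃ (K : ℕ) (C : ℝ), 0 ≤ C ∧ ∀ f g, sn N (β f g) ≤ C * sn K f * sn K g) :
    ∃ T : 𝓢(E × F, ℂ) →L[ℂ] 𝓢(G, ℂ), ∀ f g, T (tensor f g) = β f g := by
  obtain ⟨T, hT⟩ := exists_hasSum_clm
    (fun i => (β.flip (A.φ i)) ∘ₗ (contractSnd (E := E) μ (A.ψ i)).toLinearMap)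
    A.summable_w fun N => by
      obtain ⟨K, C, hC, h⟩ := hβ N
      obtain ⟨K', C', hC', h'⟩ := A.contract_bound (E := E) K K
      refine ⟨K', C * C', mul_nonneg hC hC', fun i Φ => ?_⟩
      refine (h (contractSnd μ (A.ψ i) Φ) (A.φ i)).trans ?_
      calc _ = C * (sn K (contractSnd μ (A.ψ i) Φ) * sn K (A.φ i)) := by ring
        _ ≤ C * (C' * A.w i * sn K' Φ) := mul_le_mul_of_nonneg_left (h' i Φ) hC
        _ = _ := by ring
  refine ⟨T, fun f g => (hT _).unique ?_⟩
  have hcont : Continuous (β f) := continuous_of_sn_le _ fun N => by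
    obtain ⟨K, C, hC, h⟩ := hβ N
    exact ⟨K, C * sn K f, mul_nonneg hC (sn_nonneg _ _), h f⟩
  have h2 : HasSum _ (β f g) := (A.hasSum g).mapL ⟨β f, hcont⟩
  convert h2 using 1
  ext1 i
  simp [contractSnd_tensor]

/-- Each function of two variables is a convergent series of elementary tensors. -/
theorem clm_ext {V : Type*} [AddCommGroup V] [Module ℂ V] [TopologicalSpace V] [T2Space V]
    {S T : 𝓢(E × F, ℂ) →L[ℂ] V} (A : SchwartzFrame F μ)
    (h : ∀ f g, S (tensor f g) = T (tensor f g)) : S = T := by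
  ext1 Φ
  have h1 := (A.hasSum_tensor Φ).mapL S
  have h2 := (A.hasSum_tensor Φ).mapL T
  simp only [h] at h1
  exact h1.unique h2

variable [MeasurableSpace E] [BorelSpace E] [SecondCountableTopology E]
  {ν : Measure E} [SFinite μ] [SFinite ν]

theorem integral_tensor_mul (f : 𝓢(E, ℂ)) (g : 𝓢(F, ℂ)) [(ν.prod μ).HasTemperateGrowth]
    (Φ : 𝓢(E × F, ℂ)) :
    ∫ z, tensor f g z * Φ z ∂(ν.prod μ) = ∫ x, f x * contractSnd μ g Φ x ∂ν := by
  rw [integral_prod]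
  · refine integral_congr_ae (Eventually.of_forall fun x => ?_)
    simp only [contractSnd_apply, ← integral_const_mul, tensor_apply, mul_assoc]
  · refine (((tensor f g).integrable (μ := ν.prod μ)).norm.mul_const (sn 0 Φ)).mono'
      ((tensor f g).continuous.mul Φ.continuous).aestronglyMeasurable
      (Eventually.of_forall fun y => ?_)
    rw [norm_mul]
    exact mul_le_mul_of_nonneg_left (norm_le_sn 0 Φ y) (norm_nonneg _)

theorem prod_bound (B : SchwartzFrame E ν) (A : SchwartzFrame F μ)
    [(ν.prod μ).HasTemperateGrowth] (N : ℕ) : ∃ (K : ℕ) (C : ℝ), 0 ≤ C ∧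
      ∀ (i : A.ι × B.ι) (Φ : 𝓢(E × F, ℂ)),
      ‖∫ z, tensor (B.ψ i.2) (A.ψ i.1) z * Φ z ∂(ν.prod μ)‖ * sn N (tensor (B.φ i.2) (A.φ i.1)) ≤
        C * (A.w i.1 * B.w i.2) * sn K Φ := by
  obtain ⟨K, C, hC, h⟩ := B.bound N
  obtain ⟨K', C', hC', h'⟩ := A.contract_bound (E := E) K N
  refine ⟨K', 2 ^ (N + 1) * C * C', by positivity, fun i Φ => ?_⟩
  rw [integral_tensor_mul]
  have h1 := h i.2 (contractSnd μ (A.ψ i.1) Φ)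
  set I := ‖∫ x, B.ψ i.2 x * contractSnd μ (A.ψ i.1) Φ x ∂ν‖
  have hw := (B.w_pos i.2).le
  have hI : 0 ≤ I := norm_nonneg _
  have hA : 0 ≤ sn N (A.φ i.1) := sn_nonneg _ _
  calc I * sn N (tensor (B.φ i.2) (A.φ i.1))
      ≤ I * (2 ^ (N + 1) * sn N (B.φ i.2) * sn N (A.φ i.1)) :=
        mul_le_mul_of_nonneg_left (sn_tensor_le _ _ _) hI
    _ = 2 ^ (N + 1) * (I * sn N (B.φ i.2)) * sn N (A.φ i.1) := by ring
    _ ≤ 2 ^ (N + 1) * (C * B.w i.2 * sn K (contractSnd μ (A.ψ i.1) Φ)) * sn N (A.φ i.1) := by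
        gcongr
    _ = 2 ^ (N + 1) * (C * B.w i.2) * (sn K (contractSnd μ (A.ψ i.1) Φ) * sn N (A.φ i.1)) := by
        ring
    _ ≤ 2 ^ (N + 1) * (C * B.w i.2) * (C' * A.w i.1 * sn K' Φ) :=
        mul_le_mul_of_nonneg_left (h' i.1 Φ) (by positivity)
    _ = _ := by ring

/-- The product of two nuclear expansions. -/
def prod (B : SchwartzFrame E ν) (A : SchwartzFrame F μ) [(ν.prod μ).HasTemperateGrowth] :
    SchwartzFrame (E × F) (ν.prod μ) where
  ι := A.ι × B.ι
  φ i := tensor (B.φ i.2) (A.φ i.1)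
  ψ i := tensor (B.ψ i.2) (A.ψ i.1)
  w i := A.w i.1 * B.w i.2
  w_pos i := mul_pos (A.w_pos _) (B.w_pos _)
  summable_w := A.summable_w.mul_of_nonneg B.summable_w (fun i => (A.w_pos i).le)
    (fun i => (B.w_pos i).le)
  bound := prod_bound B A
  expand Φ z := by
    obtain ⟨K, C, hC, h⟩ := prod_bound B A 0
    have hw := A.summable_w.mul_of_nonneg B.summable_w (fun i => (A.w_pos i).le)
      (fun i => (B.w_pos i).le)
    have hs : Summable fun i : A.ι × B.ι =>
        (∫ y, tensor (B.ψ i.2) (A.ψ i.1) y * Φ y ∂(ν.prod μ)) *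
          tensor (B.φ i.2) (A.φ i.1) z := by
      refine .of_norm (((hw.mul_left C).mul_right (sn K Φ)).of_nonneg_of_le
        (fun _ => norm_nonneg _) fun i => ?_)
      rw [norm_mul]
      exact (mul_le_mul_of_nonneg_left (norm_le_sn 0 _ z) (norm_nonneg _)).trans (h i Φ)
    have h1 : ∀ i, HasSum (fun l => (∫ y, tensor (B.ψ l) (A.ψ i) y * Φ y ∂(ν.prod μ)) *
          tensor (B.φ l) (A.φ i) z) (contractSnd μ (A.ψ i) Φ z.1 * A.φ i z.2) := fun i => by
      have h2 := (B.expand (contractSnd μ (A.ψ i) Φ) z.1).mul_right (A.φ i z.2)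
      simp only [integral_tensor_mul]
      simpa only [tensor_apply, mul_assoc] using h2
    -- Summing over the first variable's frame leaves the expansion of the slice at `z.1` in the
    -- second variable's frame; both iterated values of the double sum are thus identified.
    have h3 := hs.hasSum.prod_fiberwise h1
    have h4 := A.expand (slice Φ z.1) z.2
    exact h3.unique h4 ▸ hs.hasSum

end Product

section Transport

variable {E F : Type} [NormedAddCommGroup E] [NormedSpace ℝ E]
  [NormedAddCommGroup F] [NormedSpace ℝ F]
  [MeasurableSpace E] [BorelSpace E] [MeasurableSpace F] [BorelSpace F]
  {μ : Measure E} {ν : Measure F}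

/-- Transport of a nuclear expansion along a linear isomorphism which preserves the measure up to a
constant. -/
def comap (A : SchwartzFrame F ν) (e : E ≃L[ℝ] F) (c : ℂ)
    (hc : ∀ f : E → ℂ, ∫ x, f x ∂μ = c * ∫ y, f (e.symm y) ∂ν) (hc0 : c ≠ 0) :
    SchwartzFrame E μ :=
  let P := SchwartzMap.compCLMOfContinuousLinearEquiv ℂ (F := ℂ) e
  let Q := SchwartzMap.compCLMOfContinuousLinearEquiv ℂ (F := ℂ) e.symm
  have hint : ∀ i (f : 𝓢(E, ℂ)), ∫ y, (c⁻¹ • P (A.ψ i)) y * f y ∂μ =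
      ∫ y, A.ψ i y * Q f y ∂ν := fun i f => by
    rw [hc, ← integral_const_mul]
    refine integral_congr_ae (Eventually.of_forall fun y => ?_)
    simp [P, Q]
    field_simp
  { ι := A.ι
    φ := fun i => P (A.φ i)
    ψ := fun i => c⁻¹ • P (A.ψ i)
    w := A.w
    w_pos := A.w_pos
    summable_w := A.summable_w
    expand := fun f x => by
      simp only [hint]
      simpa [P, Q] using A.expand (Q f) (e x)
    bound := fun N => by
      obtain ⟨K, C, hC, h⟩ := exists_sn_map_le P N
      obtain ⟨K', C', hC', h'⟩ := A.bound K
      obtain ⟨K₂, C₂, hC₂, h₂⟩ := exists_sn_map_le Q K'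
      refine ⟨K₂, C * C' * C₂, by positivity, fun i f => ?_⟩
      rw [hint]
      have hw := (A.w_pos i).le
      calc _ ≤ ‖∫ y, A.ψ i y * Q f y ∂ν‖ * (C * sn K (A.φ i)) := by gcongr; exact h _
        _ = C * (‖∫ y, A.ψ i y * Q f y ∂ν‖ * sn K (A.φ i)) := by ring
        _ ≤ C * (C' * A.w i * sn K' (Q f)) := mul_le_mul_of_nonneg_left (h' i _) hC
        _ ≤ C * (C' * A.w i * (C₂ * sn K₂ f)) := by gcongr; exact h₂ f
        _ = _ := by ring }

/-- By uniqueness of Haar measure a linear isomorphism preserves it up to a nonzero constant, which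
`comap` absorbs into the analysing functions. -/
theorem nonempty_of_equiv [FiniteDimensional ℝ E] [μ.IsAddHaarMeasure] [ν.IsAddHaarMeasure]
    (A : SchwartzFrame F ν) (e : E ≃L[ℝ] F) : Nonempty (SchwartzFrame E μ) := by
  have : FiniteDimensional ℝ F := e.toLinearEquiv.finiteDimensional
  have : (ν.map e.symm).IsAddHaarMeasure := e.symm.isAddHaarMeasure_map ν
  have h1 := Measure.isAddLeftInvariant_eq_smul μ (ν.map e.symm)
  set r := Measure.addHaarScalarFactor μ (ν.map e.symm)
  have hr : r ≠ 0 := (Measure.addHaarScalarFactor_pos_of_isAddHaarMeasure μ (ν.map e.symm)).ne'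
  refine ⟨A.comap e (r : ℝ) (fun f => ?_) (by exact_mod_cast hr)⟩
  rw [h1, integral_smul_nnreal_measure]
  have h2 : ∫ x, f x ∂(ν.map e.symm) = ∫ y, f (e.symm y) ∂ν :=
    integral_map_equiv e.symm.toHomeomorph.toMeasurableEquiv f
  rw [h2, NNReal.smul_def, Complex.real_smul]

end Transport

end SchwartzFrame

end ModulationSpaces

namespace ModulationSpaces

/-! ### Translations, modulations and the Gabor expansion on the real line -/

section Translate

variable {E : Type} [NormedAddCommGroup E] [NormedSpace ℝ E]

theorem one_add_pow_mul_le_sn {k n N : ℕ} (hk : k ≤ N) (hn : n ≤ N) (f : 𝓢(E, ℂ)) (x : E) :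
    (1 + ‖x‖) ^ k * ‖iteratedFDeriv ℝ n f x‖ ≤ 2 ^ N * sn N f :=
  SchwartzMap.one_add_le_sup_seminorm_apply (𝕜 := ℂ) (m := (N, N)) hk hn f x

/-- The inequality `‖x‖ ≤ (1 + ‖a‖)(1 + ‖x - a‖)` limits the growth in `a` to a polynomial one. -/
theorem sn_translate_le (N : ℕ) (a : E) (f : 𝓢(E, ℂ)) :
    sn N (SchwartzMap.compSubConstCLM ℂ a f) ≤ 2 ^ N * (1 + ‖a‖) ^ N * sn N f := by
  have h0 : 0 ≤ 2 ^ N * (1 + ‖a‖) ^ N * sn N f := mul_nonneg (by positivity) (sn_nonneg _ _)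
  refine sn_le h0 fun k hk n hn => SchwartzMap.seminorm_le_bound ℂ k n _ h0 fun x => ?_
  have e : iteratedFDeriv ℝ n (SchwartzMap.compSubConstCLM ℂ a f) x =
      iteratedFDeriv ℝ n f (x - a) := iteratedFDeriv_comp_sub n a x
  rw [e]
  have h1 : ‖x‖ ^ k ≤ (1 + ‖a‖) ^ N * (1 + ‖x - a‖) ^ k := by
    have h2 : ‖x‖ ≤ (1 + ‖a‖) * (1 + ‖x - a‖) := by
      have : ‖x‖ ≤ ‖x - a‖ + ‖a‖ := by simpa using norm_add_le (x - a) a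
      nlinarith [mul_nonneg (norm_nonneg a) (norm_nonneg (x - a))]
    calc ‖x‖ ^ k ≤ ((1 + ‖a‖) * (1 + ‖x - a‖)) ^ k := by gcongr
      _ = (1 + ‖a‖) ^ k * (1 + ‖x - a‖) ^ k := mul_pow _ _ _
      _ ≤ _ := by gcongr; simp
  calc _ ≤ (1 + ‖a‖) ^ N * (1 + ‖x - a‖) ^ k * ‖iteratedFDeriv ℝ n f (x - a)‖ := by gcongr
    _ = (1 + ‖a‖) ^ N * ((1 + ‖x - a‖) ^ k * ‖iteratedFDeriv ℝ n f (x - a)‖) := by ring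
    _ ≤ (1 + ‖a‖) ^ N * (2 ^ N * sn N f) :=
        mul_le_mul_of_nonneg_left (one_add_pow_mul_le_sn hk hn f _) (by positivity)
    _ = _ := by ring

theorem one_add_pow_mul_sn_slice_le {F : Type} [NormedAddCommGroup F] [NormedSpace ℝ F]
    (Φ : 𝓢(E × F, ℂ)) (x : E) (m N : ℕ) :
    (1 + ‖x‖) ^ m * sn N (slice Φ x) ≤ 2 ^ m * sn (m + N) Φ := by
  rw [add_comm, add_pow, Finset.sum_mul]
  calc _ ≤ ∑ i ∈ Finset.range (m + 1), (m.choose i : ℝ) * sn (m + N) Φ := by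
        refine Finset.sum_le_sum fun i hi => ?_
        have h1 := (sn_slice_le Φ x i N).trans
          (sn_mono (by have := Finset.mem_range.1 hi; omega) Φ : _ ≤ sn (m + N) Φ)
        calc _ = (m.choose i : ℝ) * (‖x‖ ^ i * sn N (slice Φ x)) := by rw [one_pow]; ring
          _ ≤ _ := mul_le_mul_of_nonneg_left h1 (by positivity)
    _ = _ := by
        rw [← Finset.sum_mul]
        congr 1
        exact_mod_cast Nat.sum_range_choose m

end Translate

/-- Multiplication of a Schwartz function by the character `x ↦ exp (2πikx)`. -/
def modulate (k : ℝ) : 𝓢(ℝ, ℂ) →L[ℂ] 𝓢(ℝ, ℂ) :=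
  (FourierTransform.fourierInvCLM ℂ 𝓢(ℝ, ℂ)) ∘L (SchwartzMap.compSubConstCLM ℂ k) ∘L
    (FourierTransform.fourierCLM ℂ 𝓢(ℝ, ℂ))

theorem modulate_apply (k : ℝ) (f : 𝓢(ℝ, ℂ)) (x : ℝ) :
    modulate k f x = Complex.exp (2 * Real.pi * k * x * Complex.I) * f x := by
  have h1 : f x = 𝓕⁻ (⇑(𝓕 f : 𝓢(ℝ, ℂ))) x := by
    rw [← SchwartzMap.fourierInv_coe, FourierTransform.fourierInv_fourier_eq]
  have h2 : modulate k f x = 𝓕⁻ (⇑(SchwartzMap.compSubConstCLM ℂ k (𝓕 f))) x := by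
    rw [← SchwartzMap.fourierInv_coe]; rfl
  rw [h1, h2, Real.fourierInv_eq', Real.fourierInv_eq', ← integral_const_mul,
    ← integral_add_right_eq_self _ k]
  refine integral_congr_ae (Eventually.of_forall fun v => ?_)
  simp only [SchwartzMap.compSubConstCLM_apply, add_sub_cancel_right, smul_eq_mul, ← mul_assoc]
  rw [← Complex.exp_add]
  congr 2
  simp
  ring

/-- Modulation is translation on the Fourier side, hence also of polynomial growth in its parameter.
-/
theorem sn_modulate_le (N : ℕ) : ∃ (K : ℕ) (C : ℝ), 0 ≤ C ∧ ∀ (k : ℝ) (f : 𝓢(ℝ, ℂ)),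
    sn N (modulate k f) ≤ C * (1 + ‖k‖) ^ K * sn K f := by
  obtain ⟨K, C, hC, h⟩ := exists_sn_map_le (FourierTransform.fourierInvCLM ℂ 𝓢(ℝ, ℂ)) N
  obtain ⟨K', C', hC', h'⟩ := exists_sn_map_le (FourierTransform.fourierCLM ℂ 𝓢(ℝ, ℂ)) K
  refine ⟨max K K', C * 2 ^ K * C', by positivity, fun k f => ?_⟩
  refine (h _).trans ?_
  calc _ ≤ C * (2 ^ K * (1 + ‖k‖) ^ K * sn K (FourierTransform.fourierCLM ℂ 𝓢(ℝ, ℂ) f)) := by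
        gcongr; exact sn_translate_le _ _ _
    _ ≤ C * (2 ^ K * (1 + ‖k‖) ^ K * (C' * sn K' f)) := by gcongr; exact h' f
    _ ≤ C * (2 ^ K * (1 + ‖k‖) ^ (max K K') * (C' * sn (max K K') f)) := by
        have h1 := sn_mono (le_max_right K K') f
        have h2 : (1 + ‖k‖) ^ K ≤ (1 + ‖k‖) ^ (max K K') :=
          pow_le_pow_right₀ (by simp) (le_max_left _ _)
        have h3 := sn_nonneg K' f
        gcongr
    _ = _ := by ring

/-! A smooth partition of unity on the line -/

theorem contDiff_partition : ContDiff ℝ ((⊤ : ℕ∞) : WithTop ℕ∞) fun x : ℝ =>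
    ((Real.smoothTransition (4 * x + 1) - Real.smoothTransition (4 * x) : ℝ) : ℂ) := by
  have h1 : ContDiff ℝ ((⊤ : ℕ∞) : WithTop ℕ∞) Real.smoothTransition := Real.smoothTransition.contDiff
  exact Complex.ofRealCLM.contDiff.comp ((h1.comp (by fun_prop)).sub (h1.comp (by fun_prop)))

theorem partition_eq_zero {x : ℝ} (hx : x ∉ Set.Icc (-(1 / 4) : ℝ) (1 / 4)) :
    ((Real.smoothTransition (4 * x + 1) - Real.smoothTransition (4 * x) : ℝ) : ℂ) = 0 := by
  rw [Complex.ofReal_eq_zero]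
  by_cases h : x < -(1 / 4)
  · rw [Real.smoothTransition.zero_of_nonpos (by linarith),
      Real.smoothTransition.zero_of_nonpos (by linarith), sub_self]
  · have h2 : 1 / 4 < x := by
      by_contra h3
      exact hx ⟨not_lt.1 h, not_lt.1 h3⟩
    rw [Real.smoothTransition.one_of_one_le (by linarith),
      Real.smoothTransition.one_of_one_le (by linarith), sub_self]

/-- A smooth function supported in `[-1/4, 1/4]` whose translates by `ℤ / 4` sum to one. -/
def partitionFun : 𝓢(ℝ, ℂ) :=
  (HasCompactSupport.intro isCompact_Icc fun _ hx => partition_eq_zero hx).toSchwartzMap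
    contDiff_partition

theorem partitionFun_apply (x : ℝ) : partitionFun x =
    ((Real.smoothTransition (4 * x + 1) - Real.smoothTransition (4 * x) : ℝ) : ℂ) := rfl

theorem partitionFun_eq_zero {x : ℝ} (hx : 1 / 4 < |x|) : partitionFun x = 0 :=
  partition_eq_zero fun h => absurd (abs_le.2 h) (not_le.2 hx)

/-- The terms are differences of consecutive values of one smooth step. Only `j = ⌊4x⌋` and `j =
⌊4x⌋ + 1` contribute, and these two telescope to `1 - 0`. -/
theorem hasSum_partitionFun (x : ℝ) : HasSum (fun j : ℤ => partitionFun (x - j / 4)) 1 := by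
  have h1 : ∀ j : ℤ, partitionFun (x - j / 4) = ((Real.smoothTransition (4 * x - j + 1) -
      Real.smoothTransition (4 * x - j) : ℝ) : ℂ) := fun j => by
    rw [partitionFun_apply]
    ring_nf
  simp only [h1]
  set m := ⌊4 * x⌋
  have hm : (m : ℝ) ≤ 4 * x := Int.floor_le _
  have hm' : 4 * x < m + 1 := Int.lt_floor_add_one _
  have h2 : HasSum (fun j : ℤ => ((Real.smoothTransition (4 * x - j + 1) -
      Real.smoothTransition (4 * x - j) : ℝ) : ℂ)) (∑ j ∈ {m, m + 1},
      ((Real.smoothTransition (4 * x - j + 1) - Real.smoothTransition (4 * x - j) : ℝ) : ℂ)) :=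
    hasSum_sum_of_ne_finset_zero fun j hj => by
    simp only [Finset.mem_insert, Finset.mem_singleton, not_or] at hj
    rw [Complex.ofReal_eq_zero]
    rcases lt_or_gt_of_ne hj.1 with h | h
    · have h3 : (j : ℝ) + 1 ≤ m := by exact_mod_cast h
      rw [Real.smoothTransition.one_of_one_le (by linarith),
        Real.smoothTransition.one_of_one_le (by linarith), sub_self]
    · have h3 : (m : ℝ) + 2 ≤ j := by
        have : m + 2 ≤ j := by omega
        exact_mod_cast this
      rw [Real.smoothTransition.zero_of_nonpos (by linarith),
        Real.smoothTransition.zero_of_nonpos (by linarith), sub_self]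
  convert h2 using 1
  rw [Finset.sum_pair (by omega), ← Complex.ofReal_add, eq_comm, Complex.ofReal_eq_one]
  push_cast
  rw [Real.smoothTransition.one_of_one_le (x := 4 * x - m + 1) (by linarith),
    Real.smoothTransition.zero_of_nonpos (x := 4 * x - (m + 1)) (by linarith),
    show 4 * x - (m + 1) + 1 = 4 * x - m by ring]
  ring

/-- A smooth function equal to one on `[-1/4, 1/4]` and supported in `(-3/4, 3/4)`. -/
def cutoffBump : ContDiffBump (0 : ℝ) := ⟨1 / 4, 3 / 4, by norm_num, by norm_num⟩

/-- The Schwartz function given by the bump function `cutoffBump`. -/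
def cutoffFun : 𝓢(ℝ, ℂ) :=
  (cutoffBump.hasCompactSupport.comp_left (g := fun x : ℝ => (x : ℂ)) (by simp)).toSchwartzMap
    (Complex.ofRealCLM.contDiff.comp cutoffBump.contDiff)

theorem cutoffFun_eq_one {x : ℝ} (hx : |x| ≤ 1 / 4) : cutoffFun x = 1 := by
  have : cutoffBump x = 1 := cutoffBump.one_of_mem_closedBall (by simpa [cutoffBump] using hx)
  change ((cutoffBump x : ℝ) : ℂ) = 1
  rw [this]; simp

theorem cutoffFun_eq_zero {x : ℝ} (hx : 3 / 4 ≤ |x|) : cutoffFun x = 0 := by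
  have : cutoffBump x = 0 := cutoffBump.zero_of_le_dist (by simpa [cutoffBump] using hx)
  change ((cutoffBump x : ℝ) : ℂ) = 0
  rw [this]; simp

end ModulationSpaces

/-! ### The Gabor expansion on the line and nuclear expansions in all finite dimensions -/

namespace ModulationSpaces

/-- The involution `(l, x) ↦ (x - l, x)` of the plane. -/
def shear : (ℝ × ℝ) ≃L[ℝ] (ℝ × ℝ) :=
  ContinuousLinearEquiv.equivOfInverse
    ((ContinuousLinearMap.snd ℝ ℝ ℝ - ContinuousLinearMap.fst ℝ ℝ ℝ).prod
      (ContinuousLinearMap.snd ℝ ℝ ℝ))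
    ((ContinuousLinearMap.snd ℝ ℝ ℝ - ContinuousLinearMap.fst ℝ ℝ ℝ).prod
      (ContinuousLinearMap.snd ℝ ℝ ℝ))
    (fun z => by ext1 <;> simp) (fun z => by ext1 <;> simp)

/-- The continuous linear map which sends `f` to the function `(l, x) ↦ ρ(x - l) f(x)`, where `ρ`
is the window `partitionFun`. -/
def windowed : 𝓢(ℝ, ℂ) →L[ℂ] 𝓢(ℝ × ℝ, ℂ) :=
  (SchwartzMap.compCLMOfContinuousLinearEquiv ℂ shear) ∘L tensorLeft partitionFun

theorem windowed_apply (f : 𝓢(ℝ, ℂ)) (l x : ℝ) :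
    windowed f (l, x) = partitionFun (x - l) * f x := rfl

/-- The analysing functions of the Gabor expansion. -/
def gaborAnalysis (i : ℤ × ℤ) : 𝓢(ℝ, ℂ) :=
  modulate (-i.2) (SchwartzMap.compSubConstCLM ℂ (i.1 / 4 : ℝ) partitionFun)

/-- The synthesizing functions of the Gabor expansion. -/
def gaborSynthesis (i : ℤ × ℤ) : 𝓢(ℝ, ℂ) :=
  modulate i.2 (SchwartzMap.compSubConstCLM ℂ (i.1 / 4 : ℝ) cutoffFun)

/-- Writing the coefficients as Fourier transforms of slices of one Schwartz function of two
variables gives rapid decay in position and frequency at once. -/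
theorem integral_gaborAnalysis (i : ℤ × ℤ) (f : 𝓢(ℝ, ℂ)) :
    ∫ y, gaborAnalysis i y * f y =
      (𝓕 (slice (windowed f) (i.1 / 4 : ℝ)) : 𝓢(ℝ, ℂ)) i.2 := by
  rw [SchwartzMap.fourier_coe, Real.fourier_eq']
  refine integral_congr_ae (Eventually.of_forall fun v => ?_)
  simp only [gaborAnalysis, modulate_apply, SchwartzMap.compSubConstCLM_apply, slice_apply,
    windowed_apply, smul_eq_mul, ← mul_assoc]
  congr 3
  simp
  ring

/-- The weight of the Gabor expansion. -/
def gaborWeight (j : ℤ) : ℝ := ((1 + ‖(j / 4 : ℝ)‖) ^ 2)⁻¹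

theorem gaborWeight_pos (j : ℤ) : 0 < gaborWeight j := by unfold gaborWeight; positivity

theorem summable_gaborWeight : Summable gaborWeight := by
  have h : Summable fun m : ℕ => 16 * (1 / ((m + 1 : ℕ) : ℝ) ^ 2) :=
    ((summable_nat_add_iff 1).2 (Real.summable_one_div_nat_pow.2 one_lt_two)).mul_left 16
  -- The factor 16 comes from `1 + m / 4 ≥ (m + 1) / 4`.
  have hb : ∀ (m : ℕ) (j : ℤ), |(j : ℝ)| = m → gaborWeight j ≤ 16 * (1 / ((m + 1 : ℕ) : ℝ) ^ 2) := by
    intro m j hj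
    have e : ‖(j / 4 : ℝ)‖ = m / 4 := by
      rw [norm_div, Real.norm_eq_abs, hj]; norm_num
    rw [gaborWeight, e, ← one_div, mul_one_div, div_le_div_iff₀ (by positivity) (by positivity)]
    push_cast
    nlinarith [(Nat.cast_nonneg m : (0 : ℝ) ≤ m)]
  refine Summable.of_nat_of_neg ?_ ?_
  · exact h.of_nonneg_of_le (fun _ => (gaborWeight_pos _).le) fun m => hb m _ (by simp)
  · exact h.of_nonneg_of_le (fun _ => (gaborWeight_pos _).le) fun m => hb m _ (by simp)

theorem exists_sn_gaborSynthesis_le (N : ℕ) : ∃ (K : ℕ) (C : ℝ), 0 ≤ C ∧ ∀ i : ℤ × ℤ,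
    sn N (gaborSynthesis i) ≤ C * (1 + ‖(i.1 / 4 : ℝ)‖) ^ K * (1 + ‖(i.2 : ℝ)‖) ^ K := by
  obtain ⟨K, C, hC, h⟩ := sn_modulate_le N
  refine ⟨K, C * 2 ^ K * sn K cutoffFun, mul_nonneg (by positivity) (sn_nonneg _ _), fun i => ?_⟩
  refine (h _ _).trans ((mul_le_mul_of_nonneg_left (sn_translate_le K _ _)
    (by positivity)).trans_eq (by ring))

theorem exists_norm_integral_gaborAnalysis_le (r : ℕ) : ∃ (K : ℕ) (C : ℝ), 0 ≤ C ∧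
    ∀ (i : ℤ × ℤ) (f : 𝓢(ℝ, ℂ)), (1 + ‖(i.1 / 4 : ℝ)‖) ^ r * (1 + ‖(i.2 : ℝ)‖) ^ r *
      ‖∫ y, gaborAnalysis i y * f y‖ ≤ C * sn K f := by
  obtain ⟨K, C, hC, h⟩ := exists_sn_map_le (FourierTransform.fourierCLM ℂ 𝓢(ℝ, ℂ)) r
  obtain ⟨K', C', hC', h'⟩ := exists_sn_map_le windowed (r + K)
  refine ⟨K', 2 ^ r * C * 2 ^ r * C', by positivity, fun i f => ?_⟩
  rw [integral_gaborAnalysis]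
  set g := slice (windowed f) (i.1 / 4 : ℝ)
  have h1 : (1 + ‖(i.2 : ℝ)‖) ^ r * ‖(𝓕 g : 𝓢(ℝ, ℂ)) i.2‖ ≤ 2 ^ r * sn r (𝓕 g : 𝓢(ℝ, ℂ)) := by
    have := one_add_pow_mul_le_sn (le_refl r) (Nat.zero_le r) (𝓕 g : 𝓢(ℝ, ℂ)) i.2
    rwa [norm_iteratedFDeriv_zero] at this
  have h2 : sn r (𝓕 g : 𝓢(ℝ, ℂ)) ≤ C * sn K g := h g
  have h3 := one_add_pow_mul_sn_slice_le (windowed f) (i.1 / 4 : ℝ) r K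
  set a := (1 + ‖(i.1 / 4 : ℝ)‖) ^ r with ha
  have ha0 : 0 ≤ a := by positivity
  calc _ = a * ((1 + ‖(i.2 : ℝ)‖) ^ r * ‖(𝓕 g : 𝓢(ℝ, ℂ)) i.2‖) := by ring
    _ ≤ a * (2 ^ r * (C * sn K g)) :=
        mul_le_mul_of_nonneg_left
          (h1.trans (mul_le_mul_of_nonneg_left h2 (by positivity))) ha0
    _ = 2 ^ r * C * (a * sn K g) := by ring
    _ ≤ 2 ^ r * C * (2 ^ r * (C' * sn K' f)) := by
        refine mul_le_mul_of_nonneg_left (h3.trans ?_) (by positivity)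
        exact mul_le_mul_of_nonneg_left (h' f) (by positivity)
    _ = _ := by ring

/-- The coefficients decay faster than any power: `r` powers absorb the growth of the synthesizing
functions, and the two remaining ones produce the summable weights. -/
theorem gabor_bound (N : ℕ) : ∃ (K : ℕ) (C : ℝ), 0 ≤ C ∧ ∀ (i : ℤ × ℤ) (f : 𝓢(ℝ, ℂ)),
    ‖∫ y, gaborAnalysis i y * f y‖ * sn N (gaborSynthesis i) ≤
      C * (gaborWeight i.1 * gaborWeight i.2) * sn K f := by
  obtain ⟨r, C, hC, h⟩ := exists_sn_gaborSynthesis_le N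
  obtain ⟨K, C', hC', h'⟩ := exists_norm_integral_gaborAnalysis_le (r + 2)
  refine ⟨K, C * C', by positivity, fun i f => ?_⟩
  have h1 := h i
  have h2 := h' i f
  have h3 : 1 + ‖(i.2 / 4 : ℝ)‖ ≤ 1 + ‖(i.2 : ℝ)‖ := by
    rw [norm_div]; norm_num; linarith [abs_nonneg (i.2 : ℝ)]
  simp only [gaborWeight]
  set a := 1 + ‖(i.1 / 4 : ℝ)‖
  set b := 1 + ‖(i.2 : ℝ)‖
  set b' := 1 + ‖(i.2 / 4 : ℝ)‖
  set I := ‖∫ y, gaborAnalysis i y * f y‖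
  have hI : 0 ≤ I := norm_nonneg _
  have ha : 0 < a := by positivity
  have hb' : 0 < b' := by positivity
  have hb : 0 < b := hb'.trans_le h3
  have h4 : I * sn N (gaborSynthesis i) * (a ^ 2 * b' ^ 2) ≤ C * C' * sn K f := by
    calc _ ≤ I * (C * a ^ r * b ^ r) * (a ^ 2 * b ^ 2) := by gcongr
      _ = C * (a ^ (r + 2) * b ^ (r + 2) * I) := by ring
      _ ≤ C * (C' * sn K f) := by gcongr
      _ = _ := by ring
  rw [← le_div_iff₀ (by positivity)] at h4
  refine h4.trans_eq ?_
  field_simp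

/-- Poisson summation: the Fourier series rebuilds the 1-periodization of the windowed function, and
the cutoff, equal to one on the support of the window, removes all its integer translates except the
original. -/
theorem hasSum_gabor_fiber (f : 𝓢(ℝ, ℂ)) (x : ℝ) (j : ℤ)
    (hs : Summable fun k : ℤ => (∫ y, gaborAnalysis (j, k) y * f y) * gaborSynthesis (j, k) x) :
    HasSum (fun k : ℤ => (∫ y, gaborAnalysis (j, k) y * f y) * gaborSynthesis (j, k) x)
      (partitionFun (x - j / 4) * f x) := by
  have h0 := hs.hasSum
  convert h0 using 1
  set g := slice (windowed f) (j / 4 : ℝ) with hg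
  have h1 := SchwartzMap.tsum_eq_tsum_fourier g x
  have h2 : ∀ k : ℤ, (∫ y, gaborAnalysis (j, k) y * f y) * gaborSynthesis (j, k) x =
      cutoffFun (x - j / 4) * ((𝓕 g : 𝓢(ℝ, ℂ)) k * fourier k (x : UnitAddCircle)) := fun k => by
    rw [integral_gaborAnalysis, gaborSynthesis, modulate_apply, fourier_coe_apply]
    simp only [SchwartzMap.compSubConstCLM_apply, ← hg]
    have : (2 * Real.pi * (k : ℝ) * x * Complex.I : ℂ) =
      2 * Real.pi * Complex.I * k * x / (1 : ℝ) := by push_cast; ring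
    rw [this]; ring
  simp only [h2, tsum_mul_left]
  rw [← h1, ← tsum_mul_left, tsum_eq_single 0]
  · simp only [hg, slice_apply, windowed_apply]
    by_cases hx : |x - j / 4| ≤ 1 / 4
    · rw [cutoffFun_eq_one hx]; simp
    · rw [Int.cast_zero, add_zero, partitionFun_eq_zero (not_le.1 hx)]; simp
  -- The cutoff vanishes unless `|x - j/4| < 3/4`; then a nonzero integer shift moves the argument
  -- beyond distance `1/4` from `j/4`, where the window vanishes.
  · intro m hm
    simp only [hg, slice_apply, windowed_apply]
    by_cases hx : 3 / 4 ≤ |x - j / 4|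
    · rw [cutoffFun_eq_zero hx, zero_mul]
    · rw [partitionFun_eq_zero (x := x + m - j / 4), zero_mul, mul_zero]
      have h5 : (1 : ℝ) ≤ |(m : ℝ)| := by exact_mod_cast Int.one_le_abs hm
      have h6 : |(m : ℝ)| ≤ |x + m - j / 4| + |x - j / 4| := by
        have := abs_sub (x + m - j / 4) (x - j / 4)
        calc |(m : ℝ)| = |(x + m - j / 4) - (x - j / 4)| := by ring_nf
          _ ≤ _ := this
      linarith [not_le.1 hx]

/-- The Gabor expansion of Schwartz functions on the real line. -/
def gaborFrame : SchwartzFrame ℝ volume where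
  ι := ℤ × ℤ
  φ := gaborSynthesis
  ψ := gaborAnalysis
  w i := gaborWeight i.1 * gaborWeight i.2
  w_pos i := mul_pos (gaborWeight_pos _) (gaborWeight_pos _)
  summable_w := summable_gaborWeight.mul_of_nonneg summable_gaborWeight
    (fun _ => (gaborWeight_pos _).le) (fun _ => (gaborWeight_pos _).le)
  bound := gabor_bound
  expand f x := by
    obtain ⟨K, C, hC, h⟩ := gabor_bound 0
    have hw := summable_gaborWeight.mul_of_nonneg summable_gaborWeight
      (fun _ => (gaborWeight_pos _).le) (fun _ => (gaborWeight_pos _).le)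
    have hs : Summable fun i : ℤ × ℤ => (∫ y, gaborAnalysis i y * f y) * gaborSynthesis i x := by
      refine .of_norm (((hw.mul_left C).mul_right (sn K f)).of_nonneg_of_le
        (fun _ => norm_nonneg _) fun i => ?_)
      rw [norm_mul]
      exact (mul_le_mul_of_nonneg_left (norm_le_sn 0 _ x) (norm_nonneg _)).trans (h i f)
    have h3 := hs.hasSum.prod_fiberwise
      fun j => hasSum_gabor_fiber f x j (hs.prod_factor j)
    have h4 := (hasSum_partitionFun x).mul_right (f x)
    rw [one_mul] at h4
    exact h3.unique h4 ▸ hs.hasSum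

/-- The trivial expansion on a space which consists of one point. -/
def pointFrame {E : Type} [NormedAddCommGroup E] [NormedSpace ℝ E] [MeasurableSpace E]
    [Subsingleton E] (μ : Measure E) (hμ : μ.real Set.univ ≠ 0) : SchwartzFrame E μ :=
  have hone : HasCompactSupport fun _ : E => (1 : ℂ) :=
    HasCompactSupport.of_compactSpace _
  let o : 𝓢(E, ℂ) := hone.toSchwartzMap contDiff_const
  have ho : ∀ x, o x = 1 := fun _ => rfl
  have hint : ∀ f : 𝓢(E, ℂ), ∫ y, (((μ.real Set.univ)⁻¹ : ℂ) • o) y * f y ∂μ = f 0 := fun f => by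
    have h1 : ∀ y, (((μ.real Set.univ)⁻¹ : ℂ) • o) y * f y = (μ.real Set.univ : ℂ)⁻¹ * f 0 :=
      fun y => by rw [Subsingleton.elim y 0]; simp [ho]
    simp only [h1, integral_const]
    have : (μ.real Set.univ : ℂ) ≠ 0 := by exact_mod_cast hμ
    rw [Complex.real_smul, ← mul_assoc, mul_inv_cancel₀ this, one_mul]
  { ι := Unit
    φ := fun _ => o
    ψ := fun _ => ((μ.real Set.univ)⁻¹ : ℂ) • o
    w := fun _ => 1
    w_pos := fun _ => one_pos
    summable_w := Summable.of_finite
    expand := fun f x => by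
      simp only [hint]
      rw [Subsingleton.elim x 0, ho, mul_one]
      exact hasSum_unique _
    bound := fun N => ⟨0, sn N o, sn_nonneg _ _, fun _ f => by
      rw [hint, mul_one, mul_comm]
      exact mul_le_mul_of_nonneg_left (norm_le_sn 0 f 0) (sn_nonneg _ _)⟩ }

/-- Schwartz spaces on finite-dimensional spaces have nuclear expansions. -/
theorem nonempty_schwartzFrame (d : ℕ) : ∀ (E : Type) [NormedAddCommGroup E] [NormedSpace ℝ E]
    [FiniteDimensional ℝ E] [MeasurableSpace E] [BorelSpace E] (μ : Measure E)
    [μ.IsAddHaarMeasure], Module.finrank ℝ E = d → Nonempty (SchwartzFrame E μ) := by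
  induction d with
  | zero =>
    intro E _ _ _ _ _ μ _ hd
    have : Subsingleton E := Module.finrank_zero_iff.1 hd
    refine ⟨pointFrame μ ?_⟩
    have h1 : μ Set.univ ≠ 0 := by simpa using NeZero.ne μ
    have h2 : μ Set.univ ≠ ⊤ := (isCompact_univ (X := E)).measure_lt_top.ne
    exact (ENNReal.toReal_pos h1 h2).ne'
  | succ d ih =>
    intro E _ _ _ _ _ μ _ hd
    -- The space is linearly isomorphic to `ℝ × ℝᵈ`: the Gabor expansion supplies the first factor,
    -- the induction hypothesis the second.
    obtain ⟨A⟩ := ih (Fin d → ℝ) volume (by simp)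
    have e : E ≃L[ℝ] ℝ × (Fin d → ℝ) := ContinuousLinearEquiv.ofFinrankEq (by simp [hd, add_comm])
    exact (gaborFrame.prod A).nonempty_of_equiv e

end ModulationSpaces

namespace ModulationSpaces

/-! ### Uniform boundedness for families of tempered distributions -/

section Bounded

variable {E : Type} [NormedAddCommGroup E] [NormedSpace ℝ E]

theorem exists_tempered_tsum {ι : Type*} (v : ι → Tempered E) {b : ι → ℝ} (hb : Summable b)
    (hb0 : ∀ i, 0 ≤ b i) {K : ℕ} (h : ∀ i f, ‖v i f‖ ≤ b i * sn K f) :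
    ∃ u : Tempered E, ∀ f, HasSum (fun i => v i f) (u f) := by
  have hs : ∀ f, Summable fun i => v i f := fun f =>
    .of_norm ((hb.mul_right (sn K f)).of_nonneg_of_le (fun _ => norm_nonneg _) fun i => h i f)
  refine ⟨SchwartzMap.mkCLMtoNormedSpace (fun f => ∑' i, v i f) (fun f g => ?_) (fun a f => ?_)
    ⟨Finset.Iic (K, K), ∑' i, b i, tsum_nonneg hb0, fun f => ?_⟩, fun f => (hs f).hasSum⟩
  · simp only [map_add]
    exact (hs f).tsum_add (hs g)
  · simp only [map_smul, RingHom.id_apply, smul_eq_mul]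
    exact tsum_mul_left
  · exact tsum_of_norm_bounded (hb.hasSum.mul_right (sn K f)) fun i => h i f

/-- A pointwise bounded family of tempered distributions is bounded on bounded families of
Schwartz functions. -/
theorem exists_bound_on_bounded_family {Λ ι : Type*} (u : Λ → Tempered E)
    (hu : ∀ f, ∃ C, ∀ a, ‖u a f‖ ≤ C) (x : ι → 𝓢(E, ℂ)) (hx : ∀ N, ∃ C, ∀ i, sn N (x i) ≤ C) :
    ∃ C, ∀ a i, ‖u a (x i)‖ ≤ C := by
  refine exists_bound_of_l1_bounded (fun a i => u a (x i)) (fun a => ?_) fun c hc => ?_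
  · obtain ⟨K, C, hC, h⟩ := exists_norm_le_sn (u a)
    obtain ⟨C', hC'⟩ := hx K
    exact ⟨C * C', fun i => (h _).trans (mul_le_mul_of_nonneg_left (hC' i) hC)⟩
  -- A bounded family defines a synthesis map from `ℓ¹` to the Schwartz space; pulling the
  -- distributions back along it makes completeness of `ℓ¹` do the work of barrelledness.
  · obtain ⟨y, hy, -⟩ := exists_hasSum_schwartz (fun i => c i • x i) fun N => by
      obtain ⟨C', hC'⟩ := hx N
      refine (hc.mul_right C').of_nonneg_of_le (fun _ => sn_nonneg _ _) fun i => ?_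
      rw [map_smul_eq_mul]
      exact mul_le_mul_of_nonneg_left (hC' i) (norm_nonneg _)
    obtain ⟨C, hC⟩ := hu y
    refine ⟨C, fun a => ?_⟩
    have h1 := (hy.mapL (u a)).tsum_eq
    simp only [map_smul, smul_eq_mul] at h1
    rw [h1]
    exact hC a

/-- A family of separately continuous bilinear forms on a Schwartz space which is pointwise bounded
is uniformly bounded by a product of norms. -/
theorem exists_joint_bound {Λ : Type*} (B : Λ → 𝓢(E, ℂ) → 𝓢(E, ℂ) → ℂ)
    (L R : Λ → 𝓢(E, ℂ) → Tempered E) (hL : ∀ i f g, L i f g = B i f g)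
    (hR : ∀ i f g, R i g f = B i f g) (hB : ∀ f g, ∃ C, ∀ i, ‖B i f g‖ ≤ C) :
    ∃ (K : ℕ) (C : ℝ), 0 ≤ C ∧ ∀ i f g, ‖B i f g‖ ≤ C * sn K f * sn K g := by
  -- For each `K`, the negation with norm index and constant both `K` yields a counterexample `f K`,
  -- `g K`. Normalized by `sn K`, these sequences are bounded in every `sn N`, since only the
  -- finitely many terms with `K < N` escape monotonicity of the norms.
  by_contra! hcon
  choose i f g h using fun K : ℕ => hcon K K (Nat.cast_nonneg K)
  have hf : ∀ K, sn K (f K) ≠ 0 := fun K h0 => by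
    have := h K
    rw [eq_zero_of_sn h0, ← hR, map_zero, map_zero] at this
    simp at this
  have hg : ∀ K, sn K (g K) ≠ 0 := fun K h0 => by
    have := h K
    rw [eq_zero_of_sn h0, ← hL, map_zero, map_zero] at this
    simp at this
  let nrm : (ℕ → 𝓢(E, ℂ)) → ℕ → 𝓢(E, ℂ) := fun x K => ((sn K (x K) : ℝ) : ℂ)⁻¹ • x K
  have hnrm : ∀ x : ℕ → 𝓢(E, ℂ), (∀ K, sn K (x K) ≠ 0) → ∀ N, ∃ C, ∀ K, sn N (nrm x K) ≤ C := by
    intro x hx N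
    refine ⟨∑ K ∈ Finset.range N, sn N (nrm x K) + 1, fun K => ?_⟩
    have hnn : 0 ≤ ∑ K ∈ Finset.range N, sn N (nrm x K) :=
      Finset.sum_nonneg fun _ _ => sn_nonneg _ _
    by_cases hK : K < N
    · have := Finset.single_le_sum (f := fun K => sn N (nrm x K)) (fun _ _ => sn_nonneg _ _)
        (Finset.mem_range.2 hK)
      linarith
    · have h1 : sn K (nrm x K) = 1 := by
        simp only [nrm]
        rw [map_smul_eq_mul, norm_inv, Complex.norm_real, Real.norm_of_nonneg (sn_nonneg _ _),
          inv_mul_cancel₀ (hx K)]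
      have := sn_mono (not_lt.1 hK) (nrm x K)
      linarith
  have h1 : ∀ y, ∃ C, ∀ p : Λ × ℕ, ‖L p.1 (nrm f p.2) y‖ ≤ C := fun y => by
    obtain ⟨C, hC⟩ := exists_bound_on_bounded_family (fun i => R i y)
      (fun x => by simpa only [hR] using hB x y) (nrm f) (hnrm f hf)
    exact ⟨C, fun p => by rw [hL, ← hR]; exact hC p.1 p.2⟩
  -- Second use of uniform boundedness, now in the other variable; the normalized first arguments
  -- have become part of the index of the family.
  obtain ⟨C, hC⟩ := exists_bound_on_bounded_family (fun p : Λ × ℕ => L p.1 (nrm f p.2)) h1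
    (nrm g) (hnrm g hg)
  obtain ⟨K, hK⟩ := exists_nat_gt C
  refine absurd (hC (i K, K) K) (not_le.2 (hK.trans ?_))
  have h2 : L (i K) (nrm f K) (nrm g K) =
      ((sn K (f K) : ℝ) : ℂ)⁻¹ * ((sn K (g K) : ℝ) : ℂ)⁻¹ * B (i K) (f K) (g K) := by
    simp only [nrm]
    rw [map_smul, hL, ← hR, map_smul, hR, smul_eq_mul, smul_eq_mul]
    ring
  have hfp : 0 < sn K (f K) := (sn_nonneg _ _).lt_of_ne (hf K).symm
  have hgp : 0 < sn K (g K) := (sn_nonneg _ _).lt_of_ne (hg K).symm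
  change (K : ℝ) < ‖L (i K) (nrm f K) (nrm g K)‖
  rw [h2, norm_mul, norm_mul, norm_inv, norm_inv, Complex.norm_real, Complex.norm_real,
    Real.norm_of_nonneg hfp.le, Real.norm_of_nonneg hgp.le, ← mul_inv, inv_mul_eq_div,
    lt_div_iff₀ (by positivity), ← mul_assoc]
  exact h K

end Bounded

/-! ### Kernels of the composition law -/

section Pairing

variable {n : ℕ}

theorem toTempered_comm (f g : 𝓢(Phase n, ℂ)) : toTempered f g = toTempered g f := by
  simp only [toTempered_apply, mul_comm]

theorem toTempered_injective (A : SchwartzFrame (Phase n) (haarΞ n)) {f g : 𝓢(Phase n, ℂ)}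
    (h : ∀ k, toTempered f k = toTempered g k) : f = g := by
  have h1 := A.hasSum f
  have h2 := A.hasSum g
  have e : ∀ i, ∫ y, A.ψ i y * f y ∂(haarΞ n) = ∫ y, A.ψ i y * g y ∂(haarΞ n) := fun i => by
    have := h (A.ψ i)
    rwa [toTempered_comm, toTempered_comm g] at this
  simp only [e] at h1
  exact h1.unique h2

theorem hasSum_tempered_apply (A : SchwartzFrame (Phase n) (haarΞ n)) (u : Tempered (Phase n))
    (f : 𝓢(Phase n, ℂ)) : HasSum (fun i => u (A.φ i) * toTempered (A.ψ i) f) (u f) := by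
  have := (A.hasSum f).mapL u
  refine hasSum_of_eq this (fun i => ?_) rfl
  rw [map_smul, smul_eq_mul, mul_comm, toTempered_apply]

theorem windowMap_toTempered_tensor (f₁ f₂ g₁ g₂ : 𝓢(Phase n, ℂ)) :
    windowMap f₂ (toTempered f₁) (tensor g₁ g₂) = toTempered f₁ g₁ * toTempered f₂ g₂ := by
  rw [windowMap, tensorWindow_apply, SchwartzFrame.contractSnd_tensor, map_smul, smul_eq_mul,
    mul_comm, toTempered_apply f₂]

theorem eq_of_windowMap_eq (A : SchwartzFrame (Phase n) (haarΞ n))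
    {Φ Ψ : 𝓢(Phase n × Phase n, ℂ)}
    (h : ∀ f₁ f₂, windowMap f₂ (toTempered f₁) Φ = windowMap f₂ (toTempered f₁) Ψ) : Φ = Ψ := by
  have e : ∀ g, contractSnd (haarΞ n) g Φ = contractSnd (haarΞ n) g Ψ := fun g =>
    toTempered_injective A fun k => by
      rw [toTempered_comm, toTempered_comm _ k]; exact h k g
  have h1 := A.hasSum_tensor Φ
  simp only [e] at h1
  exact h1.unique (A.hasSum_tensor Ψ)

end Pairing

namespace CompositionLaw

variable {n : ℕ} (S : CompositionLaw n)

theorem toTempered_mul_left (f g h : 𝓢(Phase n, ℂ)) :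
    toTempered (S.mul f g) h = toTempered f (S.mul g h) := by
  rw [toTempered_apply, toTempered_apply, ← S.integral_mul, ← S.integral_mul, S.assoc]

/-- `∫ f # g # h` is invariant under cyclic permutation, by associativity and the symmetry of the
pairing. -/
theorem toTempered_mul_cycle (f g h : 𝓢(Phase n, ℂ)) :
    toTempered (S.mul f g) h = toTempered (S.mul h f) g := by
  rw [toTempered_comm, ← toTempered_mul_left]

theorem toTempered_mul_mul (a f b h : 𝓢(Phase n, ℂ)) :
    toTempered (S.mul (S.mul a f) b) h = toTempered f (S.mul (S.mul b h) a) := by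
  rw [toTempered_mul_left, toTempered_mul_cycle, toTempered_comm]

variable {S}

theorem toTempered_sandwich (hB : S.Regular) (f : 𝓢(Phase n, ℂ)) (u : Tempered (Phase n))
    (g h : 𝓢(Phase n, ℂ)) : toTempered (sandwich hB f u g) h = u (S.mul (S.mul g h) f) :=
  congrArg (fun v : Tempered (Phase n) => v h) (hB f g u).choose_spec

variable (A : SchwartzFrame (Phase n) (haarΞ n))

/-- Normalized matrix coefficients of the maps `u ↦ a # u # b`. -/
def coef (S : CompositionLaw n) (N M : ℕ) (p : A.ι × A.ι) (a b : 𝓢(Phase n, ℂ)) : ℂ :=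
  ((sn N (A.φ p.1) / A.w p.1 * (sn M (A.φ p.2) / A.w p.2) : ℝ) : ℂ) *
    toTempered (S.mul (S.mul a (A.ψ p.1)) b) (A.ψ p.2)

theorem norm_toTempered_mul_le (N : ℕ) : ∃ (K : ℕ) (C : ℝ), 0 ≤ C ∧ ∀ i f,
    sn N (A.φ i) / A.w i * ‖toTempered (A.ψ i) f‖ ≤ C * sn K f := by
  obtain ⟨K, C, hC, h⟩ := A.bound N
  refine ⟨K, C, hC, fun i f => ?_⟩
  have hw := A.w_pos i
  rw [div_mul_eq_mul_div, div_le_iff₀ hw, mul_comm]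
  exact (h i f).trans_eq (by ring)

/-- For an `ℓ¹` sequence `c`, the series `∑ c i · (sn N (φ i) / w i) · ψ i` defines a tempered
distribution `u`. Regularity makes `a # u # b` a Schwartz function, so its normalized coefficients
are bounded; uniform boundedness on `ℓ¹` then bounds all matrix entries together. -/
theorem exists_coef_bound (hB : S.Regular) (N M : ℕ) (a b : 𝓢(Phase n, ℂ)) :
    ∃ C, ∀ p, ‖coef A S N M p a b‖ ≤ C := by
  obtain ⟨K, C, hC, h⟩ := norm_toTempered_mul_le A N
  obtain ⟨K', C', hC', h'⟩ := norm_toTempered_mul_le A M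
  have hnn : ∀ N i, 0 ≤ sn N (A.φ i) / A.w i := fun N i => div_nonneg (sn_nonneg _ _) (A.w_pos i).le
  have hnorm : ∀ N i f, ‖((sn N (A.φ i) / A.w i : ℝ) : ℂ) * toTempered (A.ψ i) f‖ =
      sn N (A.φ i) / A.w i * ‖toTempered (A.ψ i) f‖ := fun N i f => by
    rw [norm_mul, Complex.norm_real, Real.norm_of_nonneg (hnn N i)]
  suffices h0 : ∃ C, ∀ l i, ‖coef A S N M (i, l) a b‖ ≤ C by
    obtain ⟨C, hC⟩ := h0
    exact ⟨C, fun p => hC p.2 p.1⟩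
  have hcoef : ∀ l i, coef A S N M (i, l) a b = ((sn M (A.φ l) / A.w l : ℝ) : ℂ) *
      (((sn N (A.φ i) / A.w i : ℝ) : ℂ) * toTempered (A.ψ i) (S.mul (S.mul b (A.ψ l)) a)) := by
    intro l i
    simp only [coef, toTempered_mul_mul]
    push_cast
    ring
  refine exists_bound_of_l1_bounded _ (fun l => ?_) fun c hc => ?_
  · refine ⟨sn M (A.φ l) / A.w l * (C * sn K (S.mul (S.mul b (A.ψ l)) a)), fun i => ?_⟩
    rw [hcoef, norm_mul, Complex.norm_real, Real.norm_of_nonneg (hnn M l), hnorm]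
    exact mul_le_mul_of_nonneg_left (h i _) (hnn M l)
  · obtain ⟨u, hu⟩ := exists_tempered_tsum
      (fun i => (c i * ((sn N (A.φ i) / A.w i : ℝ) : ℂ)) • toTempered (A.ψ i))
      (hc.mul_right C) (fun i => mul_nonneg (norm_nonneg _) hC) (K := K) fun i f => by
        change ‖(c i * ((sn N (A.φ i) / A.w i : ℝ) : ℂ)) * toTempered (A.ψ i) f‖ ≤ _
        rw [mul_assoc, norm_mul, hnorm, mul_assoc]
        exact mul_le_mul_of_nonneg_left (h i f) (norm_nonneg _)
    refine ⟨C' * sn K' (sandwich hB a u b), fun l => ?_⟩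
    refine le_trans (le_of_eq ?_) (h' l (sandwich hB a u b))
    rw [← hnorm, toTempered_comm, toTempered_sandwich, ← (hu _).tsum_eq, ← tsum_mul_left]
    congr 1
    refine tsum_congr fun i => ?_
    rw [hcoef]
    change _ = _ * ((c i * ((sn N (A.φ i) / A.w i : ℝ) : ℂ)) * toTempered (A.ψ i) _)
    ring

theorem exists_coef_joint_bound (hB : S.Regular) (N M : ℕ) : ∃ (K : ℕ) (C : ℝ), 0 ≤ C ∧
    ∀ p a b, ‖coef A S N M p a b‖ ≤ C * sn K a * sn K b := by
  let t : A.ι × A.ι → ℂ := fun p =>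
    ((sn N (A.φ p.1) / A.w p.1 * (sn M (A.φ p.2) / A.w p.2) : ℝ) : ℂ)
  refine exists_joint_bound (coef A S N M)
    (fun p a => t p • (toTempered (A.ψ p.2) ∘L S.lmul (S.mul a (A.ψ p.1))))
    (fun p b => t p • (toTempered (A.ψ p.2) ∘L S.rmul b ∘L S.rmul (A.ψ p.1)))
    (fun p a b => ?_) (fun p a b => ?_) (exists_coef_bound A hB N M)
  · change t p * toTempered (A.ψ p.2) (S.mul (S.mul a (A.ψ p.1)) b) = _
    rw [toTempered_comm]; rfl
  · change t p * toTempered (A.ψ p.2) (S.mul (S.mul a (A.ψ p.1)) b) = _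
    rw [toTempered_comm]; rfl

/-- The quantitative form of regularity. Expanding `a # ψ i # b` in the frame and inserting the
joint bound on the coefficients leaves a sum of the weights over the second index, while the weight
of the first index remains available for later summations over `i`. -/
theorem exists_sn_mul_mul_le (hB : S.Regular) (N M : ℕ) : ∃ (K : ℕ) (C : ℝ), 0 ≤ C ∧
    ∀ i a b, sn N (A.φ i) * sn M (S.mul (S.mul a (A.ψ i)) b) ≤
      C * A.w i * (sn K a * sn K b) := by
  obtain ⟨K, C, hC, h⟩ := exists_coef_joint_bound A hB N M
  have hW : 0 ≤ ∑' l, A.w l := tsum_nonneg fun l => (A.w_pos l).le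
  refine ⟨K, C * ∑' l, A.w l, mul_nonneg hC hW, fun i a b => ?_⟩
  set s := S.mul (S.mul a (A.ψ i)) b with hs
  have hwi := A.w_pos i
  have h1 := sn_le_tsum (A.hasSum s) (A.summable_sn s M)
  calc sn N (A.φ i) * sn M s
      ≤ sn N (A.φ i) * ∑' l, sn M ((∫ y, A.ψ l y * s y ∂(haarΞ n)) • A.φ l) :=
        mul_le_mul_of_nonneg_left h1 (sn_nonneg _ _)
    _ = ∑' l, sn N (A.φ i) * sn M ((∫ y, A.ψ l y * s y ∂(haarΞ n)) • A.φ l) :=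
        tsum_mul_left.symm
    _ ≤ ∑' l, A.w l * (C * A.w i * (sn K a * sn K b)) := by
        refine ((A.summable_sn s M).mul_left _).tsum_le_tsum (fun l => ?_)
          (A.summable_w.mul_right _)
        have hwl := A.w_pos l
        have h2 := h (i, l) a b
        rw [coef, norm_mul, Complex.norm_real, Real.norm_of_nonneg (mul_nonneg
          (div_nonneg (sn_nonneg _ _) hwi.le) (div_nonneg (sn_nonneg _ _) hwl.le)),
          toTempered_comm, ← hs, toTempered_apply, div_mul_div_comm, div_mul_eq_mul_div,
          div_le_iff₀ (mul_pos hwi hwl)] at h2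
        rw [map_smul_eq_mul]
        calc _ = sn N (A.φ i) * sn M (A.φ l) * ‖∫ y, A.ψ l y * s y ∂(haarΞ n)‖ := by ring
          _ ≤ _ := h2
          _ = _ := by ring
    _ = _ := by rw [tsum_mul_right]; ring

end CompositionLaw

end ModulationSpaces

/-! ### Parseval's identity, the trace formula and the kernel map -/

namespace ModulationSpaces

variable {n : ℕ}

/-- The symplectic Fourier transformation satisfies Parseval's identity up to a constant. -/
theorem exists_parseval_const (n : ℕ) : ∃ κ : ℂ, κ ≠ 0 ∧ ∀ f g : 𝓢(Phase n, ℂ),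
    ∫ Z, sympFourier n f (-Z) * sympFourier n g Z ∂(haarΞ n) = κ * toTempered f g := by
  set r : ℝ := ((2 * Real.pi) ^ n)⁻¹ with hr
  have hr0 : (r : ℂ) ≠ 0 := by
    rw [hr]; norm_cast; positivity
  have : ((haarΞ n).map (rotate n)).IsAddHaarMeasure :=
    (rotate n).isAddHaarMeasure_map (haarΞ n)
  have h1 := Measure.isAddLeftInvariant_eq_smul ((haarΞ n).map (rotate n)) volume
  -- The constant by which `rotate n` scales the measure; only its being nonzero matters later.
  set c := Measure.addHaarScalarFactor ((haarΞ n).map (rotate n)) volume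
  have hc : c ≠ 0 := (Measure.addHaarScalarFactor_pos_of_isAddHaarMeasure _ _).ne'
  refine ⟨(c : ℝ) * r, mul_ne_zero (by exact_mod_cast hc) hr0, fun f g => ?_⟩
  have e : ∀ (f : 𝓢(Phase n, ℂ)) Z,
      sympFourier n f Z = r * (𝓕 f : 𝓢(Phase n, ℂ)) (rotate n Z) := fun f Z => by
    change (r • (𝓕 f : 𝓢(Phase n, ℂ)) (rotate n Z) : ℂ) = _
    rw [Complex.real_smul]
  have h2 : ∫ Z, sympFourier n f (-Z) * sympFourier n g Z ∂(haarΞ n) =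
      ∫ Z, (r * (𝓕 f : 𝓢(Phase n, ℂ)) (-Z)) * (r * (𝓕 g : 𝓢(Phase n, ℂ)) Z)
        ∂((haarΞ n).map (rotate n)) := by
    have := integral_map_equiv (μ := haarΞ n) (rotate n).toHomeomorph.toMeasurableEquiv
      (fun Z => (r * (𝓕 f : 𝓢(Phase n, ℂ)) (-Z)) * (r * (𝓕 g : 𝓢(Phase n, ℂ)) Z))
    refine Eq.trans ?_ this.symm
    refine integral_congr_ae (Eventually.of_forall fun Z => ?_)
    simp [e]
  have h3 : ∀ Z, (𝓕 f : 𝓢(Phase n, ℂ)) (-Z) = (𝓕⁻ f : 𝓢(Phase n, ℂ)) Z := fun Z => by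
    rw [SchwartzMap.fourier_coe, SchwartzMap.fourierInv_coe, Real.fourierInv_eq_fourier_neg]
  rw [h2, h1, integral_smul_nnreal_measure, toTempered_apply, integral_haarΞ, NNReal.smul_def,
    Complex.real_smul, Complex.real_smul, ← hr]
  have h4 := SchwartzMap.integral_fourierInv_mul_eq f (𝓕 g : 𝓢(Phase n, ℂ))
  rw [FourierTransform.fourierInv_fourier_eq] at h4
  have h5 : ∫ Z, (r * (𝓕 f : 𝓢(Phase n, ℂ)) (-Z)) * (r * (𝓕 g : 𝓢(Phase n, ℂ)) Z) =
      r * r * ∫ Z, f Z * g Z := by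
    rw [← h4, ← integral_const_mul]
    refine integral_congr_ae (Eventually.of_forall fun Z => ?_)
    simp only [h3]
    ring
  rw [h5]
  ring

/-- A right inverse of the symplectic Fourier transformation. -/
theorem exists_sympFourier_rightInverse (n : ℕ) : ∃ T : 𝓢(Phase n, ℂ) →L[ℂ] 𝓢(Phase n, ℂ),
    ∀ f, sympFourier n (T f) = f := by
  set r : ℝ := ((2 * Real.pi) ^ n)⁻¹ with hr
  have hr0 : r ≠ 0 := by rw [hr]; positivity
  refine ⟨r⁻¹ • ((FourierTransform.fourierInvCLM ℂ 𝓢(Phase n, ℂ)) ∘L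
    SchwartzMap.compCLMOfContinuousLinearEquiv ℂ (rotate n).symm), fun f => ?_⟩
  ext Z
  set g : 𝓢(Phase n, ℂ) := SchwartzMap.compCLMOfContinuousLinearEquiv ℂ (rotate n).symm f
  have h1 : sympFourier n (r⁻¹ • (𝓕⁻ g : 𝓢(Phase n, ℂ))) Z =
      r • (𝓕 (r⁻¹ • (𝓕⁻ g : 𝓢(Phase n, ℂ))) : 𝓢(Phase n, ℂ)) (rotate n Z) := rfl
  refine h1.trans ?_
  have h2 : (𝓕 (r⁻¹ • (𝓕⁻ g : 𝓢(Phase n, ℂ))) : 𝓢(Phase n, ℂ)) = r⁻¹ • g := by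
    rw [FourierTransform.fourier_smul, FourierTransform.fourier_fourierInv_eq]
  rw [h2, smul_apply, smul_smul, mul_inv_cancel₀ hr0, one_smul]
  simp [g]

theorem exists_integral_norm_le_sn (n : ℕ) : ∃ (K : ℕ) (C : ℝ), 0 ≤ C ∧ ∀ f : 𝓢(Phase n, ℂ),
    ∫ Z, ‖f Z‖ ∂(haarΞ n) ≤ C * sn K f := by
  set C := 2 ^ (haarΞ n).integrablePower *
    ∫ x, (1 + ‖x‖) ^ (-((haarΞ n).integrablePower : ℝ)) ∂(haarΞ n) with hCdef
  have hC : 0 ≤ C := mul_nonneg (by positivity) (integral_nonneg fun _ => by positivity)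
  refine ⟨(haarΞ n).integrablePower, C * 2, by positivity, fun f => ?_⟩
  have h := SchwartzMap.integral_pow_mul_iteratedFDeriv_le ℂ (haarΞ n) f 0 0
  simp only [pow_zero, one_mul, norm_iteratedFDeriv_zero, zero_add] at h
  refine h.trans ?_
  rw [← hCdef, mul_assoc C]
  refine mul_le_mul_of_nonneg_left ?_ hC
  have h1 := seminorm_le_sn (Nat.zero_le (haarΞ n).integrablePower) (Nat.zero_le _) f
  have h2 := seminorm_le_sn le_rfl (Nat.zero_le (haarΞ n).integrablePower) f
  linarith

theorem SchwartzFrame.countable {E : Type} [NormedAddCommGroup E] [NormedSpace ℝ E]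
    [MeasurableSpace E] {μ : Measure E} (A : SchwartzFrame E μ) : Countable A.ι := by
  have h := A.summable_w.countable_support
  have e : Function.support A.w = Set.univ := Set.eq_univ_of_forall fun i => (A.w_pos i).ne'
  rw [e] at h
  exact Set.countable_univ_iff.1 h

namespace CompositionLaw

variable {S : CompositionLaw n} (A : SchwartzFrame (Phase n) (haarΞ n))

/-- Formally, expand `u = ∑ u(φ i) ψ i` and multiply termwise. The nuclear estimate gives
convergence in the Schwartz space, and pairing with test functions identifies the limit. -/
theorem hasSum_sandwich (hB : S.Regular) (a b : 𝓢(Phase n, ℂ)) (u : Tempered (Phase n)) :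
    HasSum (fun i => u (A.φ i) • S.mul (S.mul a (A.ψ i)) b) (sandwich hB a u b) := by
  obtain ⟨N, C, hC, h⟩ := exists_norm_le_sn u
  obtain ⟨s, hs, -⟩ := exists_hasSum_schwartz (fun i => u (A.φ i) • S.mul (S.mul a (A.ψ i)) b)
    fun M => by
      obtain ⟨K, C', hC', h'⟩ := exists_sn_mul_mul_le A hB N M
      refine (((A.summable_w.mul_left C').mul_right (sn K a * sn K b)).mul_left C).of_nonneg_of_le
        (fun _ => sn_nonneg _ _) fun i => ?_
      rw [map_smul_eq_mul]
      refine (mul_le_mul_of_nonneg_right (h (A.φ i)) (sn_nonneg _ _)).trans ?_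
      rw [mul_assoc]
      exact mul_le_mul_of_nonneg_left (h' i a b) hC
  have e : s = sandwich hB a u b := toTempered_injective A fun k => by
    rw [toTempered_sandwich, toTempered_comm]
    refine (hs.mapL (toTempered k)).unique ?_
    refine hasSum_of_eq (hasSum_tempered_apply A u (S.mul (S.mul b k) a)) (fun i => ?_) rfl
    rw [map_smul, smul_eq_mul, toTempered_comm, toTempered_mul_mul]
  exact e ▸ hs

/-- The trace of the map `u ↦ x # u # y` is a multiple of `∫ x · ∫ y`. -/
theorem exists_hasSum_trace (hB : S.Regular) (hC : Orthogonal hB) :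
    ∃ κ : ℂ, κ ≠ 0 ∧ ∀ x y : 𝓢(Phase n, ℂ),
      HasSum (fun i => toTempered (S.mul (S.mul x (A.ψ i)) y) (A.φ i))
        (κ * ((∫ Z, x Z ∂(haarΞ n)) * ∫ Z, y Z ∂(haarΞ n))) := by
  obtain ⟨κ, hκ, hP⟩ := exists_parseval_const n
  refine ⟨κ⁻¹, inv_ne_zero hκ, fun x y => ?_⟩
  have := A.countable
  set s : A.ι → 𝓢(Phase n, ℂ) := fun i => S.mul (S.mul x (A.ψ i)) y with hs
  set F : A.ι → Phase n → ℂ := fun i Z => sympFourier n (A.φ i) (-Z) * sympFourier n (s i) Z with hF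
  have hnorm : ∀ i Z, ‖F i Z‖ ≤ sn 0 (sympFourier n (A.φ i)) * ‖sympFourier n (s i) Z‖ :=
    fun i Z => by
      simp only [hF, norm_mul]
      exact mul_le_mul_of_nonneg_right (norm_le_sn 0 _ _) (norm_nonneg _)
  have hInt : ∀ i, Integrable (fun Z => ‖sympFourier n (s i) Z‖) (haarΞ n) :=
    fun i => (SchwartzMap.integrable _).norm
  have hFi : ∀ i, Integrable (F i) (haarΞ n) := fun i =>
    ((hInt i).const_mul _).mono'
      (((sympFourier n (A.φ i)).continuous.comp continuous_neg).mul
        (sympFourier n (s i)).continuous).aestronglyMeasurable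
      (Eventually.of_forall fun Z => hnorm i Z)
  -- Absolute summability of the integrals justifies exchanging the trace series with the integral
  -- over `Z`.
  have hFs : Summable fun i => ∫ Z, ‖F i Z‖ ∂(haarΞ n) := by
    obtain ⟨N, C, hC, h⟩ := exists_sn_map_le (sympFourier n) 0
    obtain ⟨K, C₂, hC₂, h₂⟩ := exists_integral_norm_le_sn n
    obtain ⟨M, C₃, hC₃, h₃⟩ := exists_sn_map_le (sympFourier n) K
    obtain ⟨K', C', hC', h'⟩ := exists_sn_mul_mul_le A hB N M
    refine (((A.summable_w.mul_left C').mul_right (sn K' x * sn K' y)).mul_left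
      (C * (C₂ * C₃))).of_nonneg_of_le (fun _ => integral_nonneg fun _ => norm_nonneg _) fun i => ?_
    calc ∫ Z, ‖F i Z‖ ∂(haarΞ n)
        ≤ ∫ Z, sn 0 (sympFourier n (A.φ i)) * ‖sympFourier n (s i) Z‖ ∂(haarΞ n) :=
          integral_mono (hFi i).norm ((hInt i).const_mul _) (hnorm i)
      _ = sn 0 (sympFourier n (A.φ i)) * ∫ Z, ‖sympFourier n (s i) Z‖ ∂(haarΞ n) :=
          integral_const_mul _ _
      _ ≤ (C * sn N (A.φ i)) * (C₂ * (C₃ * sn M (s i))) := by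
          refine mul_le_mul (h _) ((h₂ _).trans (mul_le_mul_of_nonneg_left (h₃ _) hC₂))
            (integral_nonneg fun _ => norm_nonneg _) (mul_nonneg hC (sn_nonneg _ _))
      _ = (C * (C₂ * C₃)) * (sn N (A.φ i) * sn M (s i)) := by ring
      _ ≤ _ := mul_le_mul_of_nonneg_left (h' i x y) (by positivity)
  have h1 := hasSum_integral_of_summable_integral_norm hFi hFs
  -- The factors of `F i Z` are the values of `e_Z` at `φ i` and of `e_{-Z}` at `x # ψ i # y`, so
  -- the sum is `⟨e_{-Z}, x # e_Z # y⟩`.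
  have h2 : ∀ Z, ∑' i, F i Z = theta hB Z x y := fun Z => by
    have h3 := (hasSum_sandwich A hB x y (expo Z)).mapL (expo (-Z))
    refine Eq.trans ?_ h3.tsum_eq
    refine tsum_congr fun i => ?_
    rw [map_smul, smul_eq_mul]
    change F i Z = sympFourier n (A.φ i) (-Z) * sympFourier n (s i) (- -Z)
    rw [neg_neg]
  simp only [h2] at h1
  rw [hC x y] at h1
  refine hasSum_of_eq (h1.mul_left κ⁻¹) (fun i => ?_) rfl
  rw [hF, hP, ← mul_assoc, inv_mul_cancel₀ hκ, one_mul, toTempered_comm]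

/-- The kernels of the maps `u ↦ a # u # b`. -/
theorem exists_kernel (hB : S.Regular) :
    ∃ β : 𝓢(Phase n, ℂ) →ₗ[ℂ] 𝓢(Phase n, ℂ) →ₗ[ℂ] 𝓢(Phase n × Phase n, ℂ),
      (∀ a b, HasSum (fun i => tensor (A.φ i) (S.mul (S.mul a (A.ψ i)) b)) (β a b)) ∧
      ∀ N, ∃ (K : ℕ) (C : ℝ), 0 ≤ C ∧ ∀ a b, sn N (β a b) ≤ C * sn K a * sn K b := by
  have hbd : ∀ N, ∃ (K : ℕ) (C : ℝ), 0 ≤ C ∧ ∀ i a b,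
      sn N (tensor (A.φ i) (S.mul (S.mul a (A.ψ i)) b)) ≤ A.w i * (C * sn K a * sn K b) := by
    intro N
    obtain ⟨K, C, hC, h⟩ := exists_sn_mul_mul_le A hB N N
    refine ⟨K, 2 ^ (N + 1) * C, by positivity, fun i a b => (sn_tensor_le N _ _).trans ?_⟩
    rw [mul_assoc]
    exact (mul_le_mul_of_nonneg_left (h i a b) (by positivity)).trans_eq (by ring)
  have hs : ∀ a b N, Summable fun i => sn N (tensor (A.φ i) (S.mul (S.mul a (A.ψ i)) b)) := by
    intro a b N
    obtain ⟨K, C, hC, h⟩ := hbd N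
    exact (A.summable_w.mul_right _).of_nonneg_of_le (fun _ => sn_nonneg _ _) fun i => h i a b
  choose β hβ using fun a b => (exists_hasSum_schwartz _ (hs a b))
  refine ⟨LinearMap.mk₂ ℂ β (fun a a' b => ?_) (fun c a b => ?_) (fun a b b' => ?_)
    (fun c a b => ?_), fun a b => (hβ a b).1, fun N => ?_⟩
  · refine (hβ (a + a') b).1.unique ?_
    convert (hβ a b).1.add (hβ a' b).1 using 2 with i
    simp only [← tensorL_apply, map_add, LinearMap.add_apply]
  · refine (hβ (c • a) b).1.unique ?_
    convert (hβ a b).1.const_smul c using 2 with i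
    simp only [← tensorL_apply, map_smul, LinearMap.smul_apply]
  · refine (hβ a (b + b')).1.unique ?_
    convert (hβ a b).1.add (hβ a b').1 using 2 with i
    simp only [← tensorL_apply, map_add]
  · refine (hβ a (c • b)).1.unique ?_
    convert (hβ a b).1.const_smul c using 2 with i
    simp only [← tensorL_apply, map_smul]
  · obtain ⟨K, C, hC, h⟩ := hbd N
    have hW : 0 ≤ ∑' l, A.w l := tsum_nonneg fun l => (A.w_pos l).le
    refine ⟨K, (∑' l, A.w l) * C, mul_nonneg hW hC, fun a b => ?_⟩
    refine ((hβ a b).2.2 N).trans (((hs a b N).tsum_le_tsum (fun i => h i a b)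
      (A.summable_w.mul_right _)).trans_eq ?_)
    rw [tsum_mul_right]
    ring

/-- Justifies calling `Φ` the kernel of `u ↦ a # u # b`: paired with `f₁ ⊗ f₂` it gives `⟨a # f₁ #
b, f₂⟩`. -/
theorem windowMap_kernel {a b : 𝓢(Phase n, ℂ)} {Φ : 𝓢(Phase n × Phase n, ℂ)}
    (h : HasSum (fun i => tensor (A.φ i) (S.mul (S.mul a (A.ψ i)) b)) Φ) (f₁ f₂ : 𝓢(Phase n, ℂ)) :
    windowMap f₂ (toTempered f₁) Φ = toTempered (S.mul (S.mul a f₁) b) f₂ := by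
  refine (h.mapL (windowMap f₂ (toTempered f₁))).unique ?_
  rw [toTempered_mul_mul]
  refine hasSum_of_eq (hasSum_tempered_apply A (toTempered f₁) (S.mul (S.mul b f₂) a))
    (fun i => ?_) rfl
  rw [windowMap_toTempered_tensor, toTempered_comm f₂, toTempered_mul_mul]

/-- Exchange of the two variables. -/
def swapVar (n : ℕ) : 𝓢(Phase n × Phase n, ℂ) →L[ℂ] 𝓢(Phase n × Phase n, ℂ) :=
  SchwartzMap.compCLMOfContinuousLinearEquiv ℂ
    (ContinuousLinearEquiv.prodComm ℝ (Phase n) (Phase n))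

theorem swapVar_swapVar (Φ : 𝓢(Phase n × Phase n, ℂ)) : swapVar n (swapVar n Φ) = Φ := rfl

theorem swapVar_tensor (f g : 𝓢(Phase n, ℂ)) : swapVar n (tensor f g) = tensor g f := by
  ext z; exact mul_comm _ _

theorem windowMap_swapVar (A : SchwartzFrame (Phase n) (haarΞ n)) (f₁ f₂ : 𝓢(Phase n, ℂ)) (Φ : 𝓢(Phase n × Phase n, ℂ)) :
    windowMap f₂ (toTempered f₁) (swapVar n Φ) = windowMap f₁ (toTempered f₂) Φ := by
  have : (windowMap f₂ (toTempered f₁)) ∘L swapVar n = windowMap f₁ (toTempered f₂) :=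
    SchwartzFrame.clm_ext (μ := haarΞ n) A fun f g => by
      simp only [ContinuousLinearMap.comp_apply, swapVar_tensor, windowMap_toTempered_tensor,
        mul_comm]
  exact congrArg (fun v : Tempered (Phase n × Phase n) => v Φ) this

/-- The transpose of the `N`-function is a surjective continuous linear map. -/
theorem exists_transpose_nMap (hB : S.Regular) (hC : Orthogonal hB) :
    ∃ T : 𝓢(Phase n × Phase n, ℂ) →L[ℂ] 𝓢(Phase n × Phase n, ℂ), Function.Surjective T ∧
      S.IsNExtension (ContinuousLinearMap.precomp ℂ T) := by
  obtain ⟨A⟩ := nonempty_schwartzFrame _ (Phase n) (haarΞ n) rfl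
  obtain ⟨β, hβ, hβb⟩ := exists_kernel A hB
  obtain ⟨κ, hκ, htr⟩ := exists_hasSum_trace A hB hC
  obtain ⟨T₀, hT₀⟩ := A.exists_extension β hβb
  have hinv : ∀ Φ, swapVar n (T₀ (swapVar n (T₀ Φ))) = κ • Φ := by
    have : (swapVar n ∘L T₀) ∘L (swapVar n ∘L T₀) = κ • ContinuousLinearMap.id ℂ _ := by
      refine SchwartzFrame.clm_ext (μ := haarΞ n) A fun a b => eq_of_windowMap_eq A fun f₁ f₂ => ?_
      have h1 := (hβ a b).mapL
        ((windowMap f₂ (toTempered f₁)) ∘L ((swapVar n ∘L T₀) ∘L swapVar n))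
      rw [← hT₀] at h1
      refine h1.unique ?_
      -- Each term is `⟨a # ψ i # b # f₂ # φ i, f₁⟩`, by cyclicity `⟨(f₁ # a) # ψ i # (b # f₂), φ
      -- i⟩`; the sum is a trace, with value `κ ∫ f₁ a · ∫ b f₂`.
      have h2 := htr (S.mul f₁ a) (S.mul b f₂)
      refine hasSum_of_eq h2 (fun i => ?_) ?_
      · simp only [ContinuousLinearMap.comp_apply, swapVar_tensor, hT₀]
        rw [windowMap_swapVar A, windowMap_kernel A (hβ _ _)]
        rw [S.toTempered_mul_cycle (S.mul _ f₂) (A.φ i) f₁]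
        simp only [S.assoc]
      · rw [S.integral_mul, S.integral_mul]
        simp [windowMap_toTempered_tensor, toTempered_apply, mul_comm]
    intro Φ
    exact congrArg (fun v : 𝓢(Phase n × Phase n, ℂ) →L[ℂ] 𝓢(Phase n × Phase n, ℂ) => v Φ) this
  have hsurj : Function.Surjective T₀ := fun Φ => by
    refine ⟨κ⁻¹ • swapVar n (T₀ (swapVar n Φ)), ?_⟩
    rw [map_smul, ← swapVar_swapVar (T₀ _), hinv, map_smul, swapVar_swapVar, smul_smul,
      inv_mul_cancel₀ hκ, one_smul]
  obtain ⟨R, hR⟩ := exists_sympFourier_rightInverse n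
  obtain ⟨T, hT⟩ := A.exists_extension
    (β.compl₁₂ (sympFourier n).toLinearMap (sympFourier n).toLinearMap) fun N => by
      obtain ⟨K, C, hC, h⟩ := hβb N
      obtain ⟨K', C', hC', h'⟩ := exists_sn_map_le (sympFourier n) K
      refine ⟨K', C * C' * C', by positivity, fun f g => ?_⟩
      refine (h _ _).trans ?_
      have h1 := h' f
      have h2 := h' g
      calc _ ≤ C * (C' * sn K' f) * (C' * sn K' g) := by
            refine mul_le_mul (mul_le_mul_of_nonneg_left h1 hC) h2 (sn_nonneg _ _) ?_
            exact mul_nonneg hC (mul_nonneg hC' (sn_nonneg _ _))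
        _ = _ := by ring
  obtain ⟨Q, hQ⟩ := A.exists_extension
    (tensorL.compl₁₂ R.toLinearMap R.toLinearMap) fun N => by
      obtain ⟨K', C', hC', h'⟩ := exists_sn_map_le R N
      refine ⟨K', 2 ^ (N + 1) * C' * C', by positivity, fun f g => ?_⟩
      refine (sn_tensor_le N _ _).trans ?_
      have h1 := h' f
      have h2 := h' g
      calc _ ≤ 2 ^ (N + 1) * (C' * sn K' f) * (C' * sn K' g) := by
            refine mul_le_mul (mul_le_mul_of_nonneg_left h1 (by positivity)) h2 (sn_nonneg _ _) ?_
            exact mul_nonneg (by positivity) (mul_nonneg hC' (sn_nonneg _ _))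
        _ = _ := by ring
  -- `Q` undoes the Fourier transformation in both variables before `T` applies it, so surjectivity
  -- of `T₀` passes to `T`.
  have hTQ : T ∘L Q = T₀ := SchwartzFrame.clm_ext (μ := haarΞ n) A fun f g => by
    rw [ContinuousLinearMap.comp_apply, hQ, hT₀]
    change T (tensor (R f) (R g)) = _
    rw [hT]
    change β (sympFourier n (R f)) (sympFourier n (R g)) = _
    rw [hR, hR]
  refine ⟨T, fun Φ => ?_, fun f₁ f₂ g₁ g₂ => ?_⟩
  · obtain ⟨Ψ, hΨ⟩ := hsurj Φ
    exact ⟨Q Ψ, by rw [← hΨ, ← hTQ]; rfl⟩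
  · change windowMap f₂ (toTempered f₁) (T (tensor g₁ g₂)) = _
    rw [hT]
    change windowMap f₂ (toTempered f₁) (β (sympFourier n g₁) (sympFourier n g₂)) = _
    rw [windowMap_kernel A (hβ _ _), toTempered_mul_left]
    rfl

end CompositionLaw

end ModulationSpaces

namespace ModulationSpaces

variable {n : ℕ}

/-! ### Injectivity of the modulation mapping -/

/-- The distributions `f ⊗ h` with Schwartz functions `f` and `h` determine a continuous linear map
on tempered distributions. -/
theorem tempered_clm_ext (A : SchwartzFrame (Phase n) (haarΞ n)) {V : Type*} [AddCommGroup V]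
    [Module ℂ V] [TopologicalSpace V] [T2Space V]
    {S T : Tempered (Phase n × Phase n) →L[ℂ] V}
    (h : ∀ f₁ f₂ : 𝓢(Phase n, ℂ), S (windowMap f₂ (toTempered f₁)) =
      T (windowMap f₂ (toTempered f₁))) : S = T := by
  have h1 : ∀ (u : Tempered (Phase n)) f₂, S (windowMap f₂ u) = T (windowMap f₂ u) := by
    intro u f₂
    obtain ⟨N, C, hC, hu⟩ := exists_norm_le_sn u
    obtain ⟨K, C', hC', hA⟩ := A.bound N
    have hs : HasSum (fun i => u (A.φ i) • toTempered (A.ψ i)) u := by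
      refine hasSum_tempered ((A.summable_w.mul_left C').mul_left C)
        (fun i => mul_nonneg hC (mul_nonneg hC' (A.w_pos i).le)) (K := K) (fun i f => ?_)
        (hasSum_tempered_apply A u)
      change ‖u (A.φ i) * toTempered (A.ψ i) f‖ ≤ _
      rw [norm_mul, mul_assoc C]
      refine (mul_le_mul_of_nonneg_right (hu _) (norm_nonneg _)).trans ?_
      rw [mul_assoc, mul_comm (sn N _)]
      exact mul_le_mul_of_nonneg_left (hA i f) hC
    have e1 := hs.mapL (S ∘L windowMap f₂)
    have e2 := hs.mapL (T ∘L windowMap f₂)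
    refine e1.unique (hasSum_of_eq e2 (fun i => ?_) rfl)
    simp only [map_smul, ContinuousLinearMap.comp_apply, h]
  ext1 F
  obtain ⟨N, C, hC, hF⟩ := exists_norm_le_sn F
  obtain ⟨K, C', hC', hA⟩ := A.contract_bound (E := Phase n) N N
  -- The expansion of Schwartz functions in the second variable, transposed: it writes `F` as a
  -- strongly convergent series of tensors of a distribution with a Schwartz function.
  have hs : HasSum (fun i => windowMap (A.ψ i) (F ∘L tensorRight (A.φ i))) F := by
    refine hasSum_tempered ((A.summable_w.mul_left C').mul_left (C * 2 ^ (N + 1)))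
      (fun i => mul_nonneg (by positivity) (mul_nonneg hC' (A.w_pos i).le)) (K := K)
      (fun i Φ => ?_) (fun Φ => (A.hasSum_tensor Φ).mapL F)
    change ‖F (tensor (contractSnd (haarΞ n) (A.ψ i) Φ) (A.φ i))‖ ≤ _
    refine (hF _).trans ((mul_le_mul_of_nonneg_left (sn_tensor_le N _ _) hC).trans ?_)
    rw [mul_assoc (2 ^ (N + 1)), ← mul_assoc C, mul_assoc (C * 2 ^ (N + 1))]
    exact mul_le_mul_of_nonneg_left (hA i Φ) (by positivity)
  refine (hs.mapL S).unique (hasSum_of_eq (hs.mapL T) (fun i => ?_) rfl)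
  exact (h1 _ _).symm

namespace CompositionLaw

variable {S : CompositionLaw n}

/-- Needed because `nMap` is a chosen extension: it must coincide with the transpose of the
surjective map. -/
theorem IsNExtension.unique {N N' : Tempered (Phase n × Phase n) →L[ℂ] Tempered (Phase n × Phase n)}
    (h : S.IsNExtension N) (h' : S.IsNExtension N') : N = N' := by
  obtain ⟨A⟩ := nonempty_schwartzFrame _ (Phase n) (haarΞ n) rfl
  refine tempered_clm_ext A fun f₁ f₂ => SchwartzFrame.clm_ext (μ := haarΞ n) A fun g₁ g₂ => ?_
  rw [h, h']

theorem modulation_injective (hB : S.Regular) (hC : Orthogonal hB) :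
    Function.Injective S.modulation := by
  obtain ⟨T, hT, hN⟩ := exists_transpose_nMap hB hC
  have h : ∃ N, S.IsNExtension N := ⟨_, hN⟩
  have e : S.nMap = ContinuousLinearMap.precomp ℂ T := by
    rw [nMap, dif_pos h]
    exact h.choose_spec.unique hN
  intro F G hFG
  rw [modulation, e] at hFG
  ext Φ
  obtain ⟨Ψ, rfl⟩ := hT Φ
  have h1 := congrArg (fun v : Tempered (Phase n × Phase n) =>
    v (SchwartzMap.compCLMOfContinuousLinearEquiv ℂ (changeVar n) Ψ)) hFG
  have h2 : SchwartzMap.compCLMOfContinuousLinearEquiv ℂ (changeVar n).symm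
      (SchwartzMap.compCLMOfContinuousLinearEquiv ℂ (changeVar n) Ψ) = Ψ := by
    ext z; simp
  change F (T (SchwartzMap.compCLMOfContinuousLinearEquiv ℂ (changeVar n).symm
      (SchwartzMap.compCLMOfContinuousLinearEquiv ℂ (changeVar n) Ψ))) =
    G (T (SchwartzMap.compCLMOfContinuousLinearEquiv ℂ (changeVar n).symm
      (SchwartzMap.compCLMOfContinuousLinearEquiv ℂ (changeVar n) Ψ))) at h1
  rwa [h2] at h1

end CompositionLaw

/-! ### Induced norms -/

/-- Pairing the second variable with a `g` normalized by `⟨h, g⟩ = 1` recovers `f` from `f ⊗ h`. -/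
theorem exists_windowMap_leftInverse {h : 𝓢(Phase n, ℂ)} (hh : h ≠ 0) :
    ∃ R : Tempered (Phase n × Phase n) →L[ℂ] Tempered (Phase n), ∀ f, R (windowMap h f) = f := by
  obtain ⟨A⟩ := nonempty_schwartzFrame _ (Phase n) (haarΞ n) rfl
  obtain ⟨g, hg⟩ : ∃ g, toTempered h g ≠ 0 := by
    by_contra! hcon
    exact hh (toTempered_injective A fun k => by rw [hcon k, toTempered_comm, map_zero])
  refine ⟨ContinuousLinearMap.precomp ℂ (tensorRight ((toTempered h g)⁻¹ • g)), fun f => ?_⟩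
  ext a
  change f (contractSnd (haarΞ n) h (tensor a ((toTempered h g)⁻¹ • g))) = f a
  rw [SchwartzFrame.contractSnd_tensor, ← toTempered_apply, map_smul, map_smul, smul_eq_mul,
    smul_eq_mul, inv_mul_cancel₀ hg, one_mul]

section Induced

variable {L : Type*} [NormedAddCommGroup L] [NormedSpace ℂ L]
  {j : L →L[ℂ] Tempered (Phase n × Phase n)}

theorem inducedNorm_definite
    {T : Tempered (Phase n × Phase n) →L[ℂ] Tempered (Phase n × Phase n)}
    (hT : Function.Injective T) {h : 𝓢(Phase n, ℂ)} (hh : h ≠ 0) (hj : Function.Injective j)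
    (f : inducedSpace j T h) (hf : inducedNorm j T h hj f = 0) : f = 0 := by
  obtain ⟨R, hR⟩ := exists_windowMap_leftInverse hh
  rw [inducedNorm_apply, norm_eq_zero] at hf
  have h1 := inducedMap_spec j T h hj f
  rw [hf, map_zero, eq_comm, map_eq_zero_iff T hT] at h1
  ext1
  rw [← hR f, h1, map_zero]
  rfl

/-- A Cauchy sequence has images converging in `L`; applying `M⁻¹`, the tensors `u k ⊗ h` converge
in tempered distributions. The left inverse `R` shows that the limit is again of the form `f ⊗ h`.
-/
theorem isBanachNorm_of_equiv [CompleteSpace L]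
    (M : Tempered (Phase n × Phase n) ≃L[ℂ] Tempered (Phase n × Phase n)) {h : 𝓢(Phase n, ℂ)}
    (hh : h ≠ 0) (hj : Function.Injective j) : IsBanachNorm (inducedNorm j M h hj) := by
  refine ⟨inducedNorm_definite M.injective hh hj, fun u hu => ?_⟩
  obtain ⟨R, hR⟩ := exists_windowMap_leftInverse hh
  have hc : CauchySeq fun k => inducedMap j M h hj (u k) := by
    refine Metric.cauchySeq_iff.2 fun ε hε => ?_
    obtain ⟨N, hN⟩ := hu ε hε
    refine ⟨N, fun k hk l hl => ?_⟩
    rw [dist_eq_norm, ← map_sub]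
    exact hN k hk l hl
  obtain ⟨x, hx⟩ := cauchySeq_tendsto_of_complete hc
  have h1 : Tendsto (fun k => windowMap h (u k : Tempered (Phase n))) atTop (𝓝 (M.symm (j x))) := by
    have h2 := ((M.symm.continuous.comp j.continuous).tendsto x).comp hx
    refine h2.congr fun k => ?_
    change M.symm (j (inducedMap j M h hj (u k))) = _
    rw [inducedMap_spec]
    exact M.symm_apply_apply _
  have h3 : Tendsto (fun k => windowMap h (u k : Tempered (Phase n))) atTop
      (𝓝 (windowMap h (R (M.symm (j x))))) := by
    have h4 := (((windowMap h ∘L R).continuous).tendsto (M.symm (j x))).comp h1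
    refine h4.congr fun k => ?_
    change windowMap h (R (windowMap h (u k : Tempered (Phase n)))) = _
    rw [hR]
  have e := tendsto_nhds_unique h1 h3
  have e' : j x = M (windowMap h (R (M.symm (j x)))) := by
    rw [← e]; exact (M.apply_symm_apply _).symm
  let v : inducedSpace j M h := ⟨R (M.symm (j x)), ⟨x, e'⟩⟩
  have hv : inducedMap j M h hj v = x := hj (by rw [inducedMap_spec, e']; rfl)
  refine ⟨v, ?_⟩
  have h5 := tendsto_iff_norm_sub_tendsto_zero.1 hx
  refine h5.congr fun k => ?_
  rw [inducedNorm_apply, map_sub, hv]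

/-- A bijective operator on the range of an embedded Banach space which extends to a continuous
linear map is an isomorphism of the Banach space. -/
theorem exists_restrict_equiv [CompleteSpace L] (hj : Function.Injective j)
    (B : Tempered (Phase n × Phase n) →L[ℂ] Tempered (Phase n × Phase n))
    (hB : Set.BijOn B (Set.range j) (Set.range j)) :
    ∃ b : L ≃L[ℂ] L, ∀ x, j (b x) = B (j x) := by
  choose b hb using fun x => hB.mapsTo (Set.mem_range_self x)
  let bl : L →ₗ[ℂ] L :=
    { toFun := b
      map_add' := fun x y => hj (by simp [hb])
      map_smul' := fun c x => hj (by simp [hb]) }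
  -- Closed graph theorem: limits in `L` are compared after applying the continuous injection `j`,
  -- where `B` is continuous.
  have hcont : Continuous bl := bl.continuous_of_seq_closed_graph fun u x y hu hv => by
    refine hj (tendsto_nhds_unique ((j.continuous.tendsto y).comp hv) ?_)
    have h1 := ((B.continuous.comp j.continuous).tendsto x).comp hu
    change Tendsto _ _ (𝓝 (j (b x)))
    rw [hb]
    exact h1.congr fun k => (hb (u k)).symm
  have hbij : Function.Bijective bl := by
    refine ⟨fun x y hxy => ?_, fun y => ?_⟩
    · have h1 : b x = b y := hxy
      refine hj (hB.injOn (Set.mem_range_self x) (Set.mem_range_self y) ?_)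
      rw [← hb, ← hb, h1]
    · obtain ⟨_, ⟨x, rfl⟩, hx⟩ := hB.surjOn (Set.mem_range_self y)
      exact ⟨x, hj ((hb x).trans hx)⟩
  exact ⟨(LinearEquiv.ofBijective bl hbij).toContinuousLinearEquivOfContinuous hcont, hb⟩

end Induced

end ModulationSpaces
end

/-! ### Comparison of the two induced spaces -/

open ModulationSpaces in
theorem mainTheorem11 (n : ℕ) (S : CompositionLaw n) (hB : S.Regular)
    (hC : CompositionLaw.Orthogonal hB)
    (L : Type*) [NormedAddCommGroup L] [NormedSpace ℂ L] [CompleteSpace L]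
    (j : L →L[ℂ] Tempered (Phase n × Phase n)) (hj : Function.Injective j)
    (M' : Tempered (Phase n × Phase n) ≃L[ℂ] Tempered (Phase n × Phase n))
    (hbij : Set.BijOn (fun F => S.modulation (M'.symm F)) (Set.range j) (Set.range j)) :
    ∀ h : 𝓢(Phase n, ℂ), h ≠ 0 →
      inducedSpace j M' h = inducedSpace j S.modulation h ∧
      IsBanachNorm (inducedNorm j M' h hj) ∧
      IsBanachNorm (inducedNorm j S.modulation h hj) ∧
      ∃ c C : ℝ, 0 < c ∧ 0 < C ∧
        ∀ (f : Tempered (Phase n)) (hf' : f ∈ inducedSpace j M' h)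
          (hf : f ∈ inducedSpace j S.modulation h),
          c * inducedNorm j M' h hj ⟨f, hf'⟩ ≤ inducedNorm j S.modulation h hj ⟨f, hf⟩ ∧
          inducedNorm j S.modulation h hj ⟨f, hf⟩ ≤ C * inducedNorm j M' h hj ⟨f, hf'⟩ := by
  intro h hh
  have hM := CompositionLaw.modulation_injective hB hC
  obtain ⟨b, hb⟩ := exists_restrict_equiv hj (S.modulation ∘L M'.symm.toContinuousLinearMap) hbij
  have hb' : ∀ x, j (b x) = S.modulation (M'.symm (j x)) := hb
  have hmem : ∀ f, f ∈ inducedSpace j M' h ↔ f ∈ inducedSpace j S.modulation h := by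
    refine fun f => ⟨fun ⟨x, hx⟩ => ⟨b x, ?_⟩, fun ⟨y, hy⟩ => ⟨b.symm y, ?_⟩⟩
    · change j x = M' (windowMap h f) at hx
      change j (b x) = S.modulation (windowMap h f)
      rw [hb', hx, M'.symm_apply_apply]
    · change j y = S.modulation (windowMap h f) at hy
      change j (b.symm y) = M' (windowMap h f)
      rw [← M'.symm_apply_eq]
      -- The converse inclusion rests on injectivity of the modulation mapping: `M(𝕄⁻¹ j(b⁻¹ y))`
      -- and `M(f ⊗ h)` agree, so their arguments do.
      refine hM ?_
      rw [← hb', b.apply_symm_apply, hy]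
  have hmap : ∀ (f : Tempered (Phase n)) (hf' : f ∈ inducedSpace j M' h)
      (hf : f ∈ inducedSpace j S.modulation h),
      inducedMap j S.modulation h hj ⟨f, hf⟩ = b (inducedMap j M' h hj ⟨f, hf'⟩) := by
    intro f hf' hf
    refine hj ?_
    rw [inducedMap_spec, hb', inducedMap_spec]
    exact congrArg S.modulation (M'.symm_apply_apply _).symm
  obtain ⟨C, hCpos, hC1⟩ := b.toContinuousLinearMap.bound
  obtain ⟨D, hDpos, hD⟩ := b.symm.toContinuousLinearMap.bound
  have hle : ∀ (f : Tempered (Phase n)) (hf' : f ∈ inducedSpace j M' h)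
      (hf : f ∈ inducedSpace j S.modulation h),
      inducedNorm j S.modulation h hj ⟨f, hf⟩ ≤ C * inducedNorm j M' h hj ⟨f, hf'⟩ := by
    intro f hf' hf
    rw [inducedNorm_apply, inducedNorm_apply, hmap f hf' hf]
    exact hC1 _
  have hge : ∀ (f : Tempered (Phase n)) (hf' : f ∈ inducedSpace j M' h)
      (hf : f ∈ inducedSpace j S.modulation h),
      inducedNorm j M' h hj ⟨f, hf'⟩ ≤ D * inducedNorm j S.modulation h hj ⟨f, hf⟩ := by
    intro f hf' hf
    rw [inducedNorm_apply, inducedNorm_apply, hmap f hf' hf]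
    have := hD (b (inducedMap j M' h hj ⟨f, hf'⟩))
    rwa [ContinuousLinearEquiv.coe_coe, b.symm_apply_apply] at this
  have hBM := isBanachNorm_of_equiv M' hh hj
  refine ⟨Submodule.ext hmem, hBM, ⟨inducedNorm_definite hM hh hj, fun u hu => ?_⟩, D⁻¹, C,
    inv_pos.2 hDpos, hCpos, fun f hf' hf => ⟨?_, hle f hf' hf⟩⟩
  -- The modulation mapping is not known here to have a continuous inverse, so completeness is
  -- transferred from `𝕄`: the lower estimate keeps the sequence Cauchy and the upper one keeps the
  -- limit.
  · have hu' : ∀ k, (u k : Tempered (Phase n)) ∈ inducedSpace j M' h := fun k => (hmem _).2 (u k).2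
    obtain ⟨v, hv⟩ := hBM.2 (fun k => ⟨u k, hu' k⟩) fun ε hε => by
      obtain ⟨N, hN⟩ := hu (ε / D) (by positivity)
      refine ⟨N, fun k hk l hl => ?_⟩
      have h1 := hge (u k - u l) (Submodule.sub_mem _ (hu' k) (hu' l)) (u k - u l).2
      have h2 := hN k hk l hl
      rw [lt_div_iff₀' hDpos] at h2
      exact h1.trans_lt h2
    refine ⟨⟨v, (hmem _).1 v.2⟩, squeeze_zero (fun _ => apply_nonneg _ _) (fun k => ?_)
      (by simpa using hv.const_mul C)⟩
    exact hle (u k - v) (Submodule.sub_mem _ (hu' k) v.2) (Submodule.sub_mem _ (u k).2 ((hmem _).1 v.2))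
  · rw [inv_mul_le_iff₀ hDpos]
    exact hge f hf' hf
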